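/- Let $\mathbb D=\{z\in\mathbb C:|z|<1\}$. For $\alpha\in(1,2)$, let $CO(\alpha)$ be the class of functions $h$ that are analytic and univalent in $\mathbb D$, with $h(0)=0$, $h'(0)=1$, such that $\mathbb C\setminus h(\mathbb D)$ is convex, $h(1)=\infty$ (that is, $|h(z)|\to\infty$ as $z\to1$ in $\mathbb D$), and the opening angle of $h(\mathbb D)$ at $\infty$ (the limit, as $R\to\infty$, of the angular measure of $\{t\in(-\pi,\pi]: Re^{it}\in h(\mathbb D)\}$) is at most $\pi\alpha$. Let $CO_H(\alpha)$ be the class of harmonic mappings $f=h+\overline g$ on $\mathbb D$ with $h\in CO(\alpha)$, $g$ analytic in $\mathbb D$, and $g'(z)=\omega(z)h'(z)$, $|\omega(z)|<1$ for $z\in\mathbb D$; $\omega$ is called the (second complex) dilatation of $f$. Let $\alpha\in(1,2)$ and $\theta\in\mathbb R$. Then every $f\in CO_H(\alpha)$ whose dilatation is $\omega(z)=\sin\big(\frac{2-\alpha}{2}\pi\big)e^{i\theta}z$ for $z\in\mathbb D$ is univalent in $\mathbb D$ and close-to-convex, i.e. $\mathbb C\setminus f(\mathbb D)$ is a union of closed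 half-lines with pairwise disjoint interiors. -/

import Mathlib

open Complex Set Filter Topology

noncomputable section

/-- The open unit disk `𝔻` in `ℂ`. -/
def unitDisk : Set ℂ := {z : ℂ | ‖z‖ < 1}

/-- The opening angle at `∞` of a plane domain `Ω`: the asymptotic angular measure, as `R → ∞`, of
the part of the circle `|w| = R` that lies in `Ω`. If the complement of `Ω` is closed, convex and
unbounded, the upper limit is a limit, equal to `2π` minus the angle of the cone of all directions
of half-lines contained in the complement. -/
def openingAngleAtInfty (Ω : Set ℂ) : ENNReal :=
  limsup (fun R : ℝ => MeasureTheory.volume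
    {t : ℝ | t ∈ Ioc (-Real.pi) Real.pi ∧ (R : ℂ) * exp ((t : ℂ) * I) ∈ Ω}) atTop

/-- The class `CO(α)` of normalized concave univalent functions on the unit disk. -/
structure IsConcaveUnivalent (α : ℝ) (h : ℂ → ℂ) : Prop where
  analytic : DifferentiableOn ℂ h unitDisk
  map_zero : h 0 = 0
  deriv_zero : deriv h 0 = 1
  univalent : InjOn h unitDisk
  convex_compl : Convex ℝ (h '' unitDisk)ᶜ
  /-- The normalization `h(1) = ∞`. -/
  map_one : Tendsto h (𝓝[unitDisk] 1) (Bornology.cobounded ℂ)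
  opening_le : openingAngleAtInfty (h '' unitDisk) ≤ ENNReal.ofReal (Real.pi * α)

/-- `f` belongs to `CO_H(α)` and has second complex dilatation `ω`: on the unit disk,
`f = h + conj g` with `h ∈ CO(α)`, `g` analytic, `g' = ω h'` and `|ω| < 1`. -/
def IsConcaveHarmonic (α : ℝ) (f ω : ℂ → ℂ) : Prop :=
  ∃ h g : ℂ → ℂ, IsConcaveUnivalent α h ∧ DifferentiableOn ℂ g unitDisk ∧
    (∀ z ∈ unitDisk, ‖ω z‖ < 1 ∧ deriv g z = ω z * deriv h z) ∧
    ∀ z ∈ unitDisk, f z = h z + (starRingEnd ℂ) (g z)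

/-- The closed half-line with end point `a` and direction `u`. -/
def closedHalfLine (a u : ℂ) : Set ℂ := {w : ℂ | ∃ t : ℝ, 0 ≤ t ∧ w = a + (t : ℂ) * u}

/-- The half-line with direction `u`, without its end point `a`: the (relative) interior of the
closed half-line. -/
def openHalfLine (a u : ℂ) : Set ℂ := {w : ℂ | ∃ t : ℝ, 0 < t ∧ w = a + (t : ℂ) * u}

/-- The complement of `Ω` is a union of closed half-lines with pairwise disjoint interiors. A pair
`(a, u)` in `S` stands for the half-line from `a` in the direction `u ≠ 0`. -/
def IsCloseToConvexDomain (Ω : Set ℂ) : Prop :=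
  ∃ S : Set (ℂ × ℂ), (∀ p ∈ S, p.2 ≠ 0) ∧
    S.PairwiseDisjoint (fun p => openHalfLine p.1 p.2) ∧
    Ωᶜ = ⋃ p ∈ S, closedHalfLine p.1 p.2

end

/-! Put `δ = (2 - α)π/2` and pass to the right half-plane by the Cayley map sending `∞` to `1`.
After multiplication by a unimodular constant, `h` becomes a function `H` with `sin δ * |H'| ≤ Re
H'`. The dilatation has modulus `sin δ * |z| < sin δ`, so the co-analytic part satisfies `|G'| < Re
H'`. The mean value theorem on segments then gives `Re (conj (ζ₂ - ζ₁) * (F ζ₂ - F ζ₁)) > 0`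
(`re_conj_mul_sub_pos`), hence univalence.

The sector condition is `IsConcaveUnivalent.exists_rotation`. The bound on the opening angle forces
the recession cone of the convex complement to contain a sector of half-angle `δ`. For `u` in the
cone, `h(𝔻)` is stable under `w ↦ w - t u`, so `h⁻¹ ∘ (h - t u)` maps the disk to itself. The
complement lies in a half-plane, so `h(𝔻)` contains arbitrarily large disks, whose centres are
hardly moved in the hyperbolic metric. By a Julia–Wolff argument the horodisks at a limit point `σ`
of their preimages are preserved. Differentiation at `t = 0` confines `h'(z) (σ - z)² conj σ` to a
half-plane (`re_conj_mul_deriv_nonneg`), and the two extreme directions `u` give the sector. If `σ ≠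
1`, the sector would keep `h` bounded along a path to `1`, against `h(1) = ∞`.

For close-to-convexity, the strict monotonicity makes `Im F` increase on vertical lines, so `Im F =
y` is a graph over part of the real axis, along which `Re F` increases. A minimum principle
(`exists_im_gt_of_mem_Ioo`), applied to the harmonic function `Im F = Im (H - G)` and to its
reflection, shows that the base of the graph is an interval. Horizontal slices of the image are
therefore open intervals, and horizontal half-lines fill the complement. -/

/-! ### The unit disk and inverses of univalent functions. -/

theorem unitDisk_eq_ball : unitDisk = Metric.ball 0 1 := by
  ext z; simp [unitDisk]

theorem isOpen_unitDisk : IsOpen unitDisk := unitDisk_eq_ball ▸ Metric.isOpen_ball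

theorem convex_unitDisk : Convex ℝ unitDisk := unitDisk_eq_ball ▸ convex_ball _ _

/-- An injective holomorphic function on a domain has open image, nonvanishing derivative and a
holomorphic inverse. -/
theorem exists_holomorphic_inverse {U : Set ℂ} (hU : IsOpen U) (hc : IsPreconnected U)
    (hne : U.Nontrivial) {h : ℂ → ℂ} (hd : DifferentiableOn ℂ h U) (hi : InjOn h U) :
    IsOpen (h '' U) ∧ (∀ z ∈ U, deriv h z ≠ 0) ∧
      ∃ g : ℂ → ℂ, (∀ z ∈ U, g (h z) = z) ∧ DifferentiableOn ℂ g (h '' U) := by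
  have han : AnalyticOnNhd ℂ h U := hd.analyticOnNhd hU
  have hopen : ∀ s ⊆ U, IsOpen s → IsOpen (h '' s) := by
    rcases han.is_constant_or_isOpen hc with ⟨w, hw⟩ | h'
    · obtain ⟨x, hx, y, hy, hxy⟩ := hne
      exact absurd (hi hx hy ((hw x hx).trans (hw y hy).symm)) hxy
    · exact h'
  set g := Function.invFunOn h U
  have hg : ∀ z ∈ U, g (h z) = z := fun z hz => hi.leftInvOn_invFunOn hz
  have hgc : ∀ z ∈ U, ContinuousAt g (h z) := by
    intro z hz
    rw [ContinuousAt, hg z hz]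
    intro s hs
    obtain ⟨t, hts, hto, hzt⟩ := mem_nhds_iff.1 hs
    have : h '' (t ∩ U) ∈ 𝓝 (h z) :=
      (hopen _ inter_subset_right (hto.inter hU)).mem_nhds ⟨z, ⟨hzt, hz⟩, rfl⟩
    rw [mem_map]
    refine mem_of_superset this ?_
    rintro _ ⟨x, hx, rfl⟩
    exact hts (by simpa [hg x hx.2] using hx.1)
  have hVo := hopen U Subset.rfl hU
  have hright : ∀ z ∈ U, ∀ᶠ w in 𝓝 (h z), h (g w) = w := by
    intro z hz
    filter_upwards [hVo.mem_nhds ⟨z, hz, rfl⟩]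
    rintro _ ⟨x, hx, rfl⟩
    rw [hg x hx]
  have hgd : ∀ z ∈ U, deriv h z ≠ 0 → DifferentiableAt ℂ g (h z) := by
    intro z hz hz'
    have h1 : HasDerivAt h (deriv h z) (g (h z)) := by
      rw [hg z hz]; exact (hd.differentiableAt (hU.mem_nhds hz)).hasDerivAt
    exact (h1.of_local_left_inverse (hgc z hz) hz' (hright z hz)).differentiableAt
  have hgd' : ∀ z ∈ U, DifferentiableAt ℂ g (h z) := by
    intro z hz
    -- Zeros of `deriv h` are isolated, since `h` is not locally constant. Near the image of such a
    -- zero the continuous inverse is holomorphic off one point, so the singularity is removable;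
    -- the chain rule then excludes the zero.
    rcases (han z hz).deriv.eventually_eq_zero_or_eventually_ne_zero with h0 | h0
    · exfalso
      obtain ⟨r, hr, hball⟩ := Metric.eventually_nhds_iff_ball.1 (h0.and (hU.mem_nhds hz))
      have hz2 : z + (r / 2 : ℝ) ∈ Metric.ball z r := by
        rw [mem_ball_iff_norm, add_sub_cancel_left, Complex.norm_real, Real.norm_of_nonneg] <;>
          linarith
      have hzz := Metric.mem_ball_self (x := z) hr
      have hbU : Metric.ball z r ⊆ U := fun x hx => (hball x hx).2
      have := Metric.isOpen_ball.is_const_of_deriv_eq_zero (convex_ball z r).isPreconnected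
        (hd.mono hbU) (fun x hx => (hball x hx).1) hzz hz2
      have := hi (hbU hzz) (hbU hz2) this
      simp [hr.ne'] at this
    · refine (analyticAt_of_differentiable_on_punctured_nhds_of_continuousAt ?_
        (hgc z hz)).differentiableAt
      rw [eventually_nhdsWithin_iff, Metric.eventually_nhds_iff_ball] at h0
      obtain ⟨r, hr, hball⟩ := h0
      have : h '' (Metric.ball z r ∩ U) ∈ 𝓝 (h z) :=
        (hopen _ inter_subset_right (Metric.isOpen_ball.inter hU)).mem_nhds
          ⟨z, ⟨Metric.mem_ball_self hr, hz⟩, rfl⟩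
      rw [eventually_nhdsWithin_iff]
      filter_upwards [this]
      rintro _ ⟨x, ⟨hx, hxU⟩, rfl⟩ hne'
      exact hgd x hxU (hball x hx (fun h' => hne' (by rw [mem_singleton_iff.1 h']; rfl)))
  refine ⟨hVo, fun z hz h0 => ?_, g, hg, ?_⟩
  · have h1 := (hgd' z hz).hasDerivAt.comp z (hd.differentiableAt (hU.mem_nhds hz)).hasDerivAt
    have h2 : HasDerivAt (g ∘ h) 1 z := by
      refine (hasDerivAt_id z).congr_of_eventuallyEq ?_
      filter_upwards [hU.mem_nhds hz] with x hx using hg x hx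
    have := h1.unique h2
    simp [h0] at this
  · rintro _ ⟨z, hz, rfl⟩
    exact (hgd' z hz).differentiableWithinAt

/-! ### Disk automorphisms and the Schwarz–Pick lemma. -/

/-- The disk automorphism taking `a` to `0`. -/
noncomputable def diskMobius (a z : ℂ) : ℂ := (z - a) / (1 - (starRingEnd ℂ) a * z)

theorem one_sub_conj_mul_ne_zero {a z : ℂ} (ha : ‖a‖ ≤ 1) (hz : ‖z‖ < 1) :
    1 - (starRingEnd ℂ) a * z ≠ 0 := by
  intro h0
  have h1 : (starRingEnd ℂ) a * z = 1 := (sub_eq_zero.1 h0).symm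
  have h2 : ‖a‖ * ‖z‖ = 1 := by simpa using congrArg norm h1
  nlinarith [norm_nonneg a, norm_nonneg z]

theorem norm_sub_sq_add_mobius (a z : ℂ) :
    ‖1 - (starRingEnd ℂ) a * z‖ ^ 2 - ‖z - a‖ ^ 2 = (1 - ‖a‖ ^ 2) * (1 - ‖z‖ ^ 2) := by
  simp only [← Complex.normSq_eq_norm_sq, Complex.normSq_apply]
  simp
  ring

theorem one_sub_norm_diskMobius_sq {a z : ℂ} (ha : ‖a‖ < 1) (hz : ‖z‖ < 1) :
    1 - ‖diskMobius a z‖ ^ 2 =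
      (1 - ‖a‖ ^ 2) * (1 - ‖z‖ ^ 2) / ‖1 - (starRingEnd ℂ) a * z‖ ^ 2 := by
  have h0 : ‖1 - (starRingEnd ℂ) a * z‖ ^ 2 ≠ 0 :=
    pow_ne_zero _ (norm_ne_zero_iff.2 (one_sub_conj_mul_ne_zero ha.le hz))
  rw [diskMobius, norm_div, div_pow, ← norm_sub_sq_add_mobius, sub_div, div_self h0]

theorem norm_diskMobius_lt_one {a z : ℂ} (ha : ‖a‖ < 1) (hz : ‖z‖ < 1) : ‖diskMobius a z‖ < 1 := by
  have h0 : 0 < ‖1 - (starRingEnd ℂ) a * z‖ :=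
    norm_pos_iff.2 (one_sub_conj_mul_ne_zero ha.le hz)
  have h1 := one_sub_norm_diskMobius_sq ha hz
  have h2 : 0 < (1 - ‖a‖ ^ 2) * (1 - ‖z‖ ^ 2) / ‖1 - (starRingEnd ℂ) a * z‖ ^ 2 := by
    have : 0 < 1 - ‖a‖ ^ 2 := by nlinarith [norm_nonneg a]
    have : 0 < 1 - ‖z‖ ^ 2 := by nlinarith [norm_nonneg z]
    positivity
  nlinarith [norm_nonneg (diskMobius a z)]

theorem differentiableOn_diskMobius {a : ℂ} (ha : ‖a‖ < 1) :
    DifferentiableOn ℂ (diskMobius a) unitDisk := by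
  intro z hz
  have := one_sub_conj_mul_ne_zero ha.le hz
  unfold diskMobius
  have h1 : DifferentiableAt ℂ (fun z : ℂ => z - a) z := by fun_prop
  have h2 : DifferentiableAt ℂ (fun z : ℂ => 1 - (starRingEnd ℂ) a * z) z := by fun_prop
  exact (h1.fun_div h2 this).differentiableWithinAt

theorem diskMobius_neg_diskMobius {a z : ℂ} (ha : ‖a‖ < 1) (hz : ‖z‖ < 1) :
    diskMobius (-a) (diskMobius a z) = z := by
  have h1 := one_sub_conj_mul_ne_zero ha.le hz
  have h2 := one_sub_conj_mul_ne_zero ha.le ha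
  unfold diskMobius
  simp only [map_neg]
  have h4 : 1 - -(starRingEnd ℂ) a * ((z - a) / (1 - (starRingEnd ℂ) a * z)) =
      (1 - (starRingEnd ℂ) a * a) / (1 - (starRingEnd ℂ) a * z) := by
    rw [eq_div_iff h1, sub_mul, mul_assoc, div_mul_cancel₀ _ h1]; ring
  have h5 : (z - a) / (1 - (starRingEnd ℂ) a * z) - -a =
      z * (1 - (starRingEnd ℂ) a * a) / (1 - (starRingEnd ℂ) a * z) := by
    rw [eq_div_iff h1, sub_mul, div_mul_cancel₀ _ h1]; ring
  rw [h4, h5, div_div_div_cancel_right₀ h1, mul_div_cancel_right₀ _ h2]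

/-- The Schwarz–Pick lemma for a map from a ball to the unit disk, based at the centre. -/
theorem norm_diskMobius_le_div {ψ : ℂ → ℂ} {c w : ℂ} {R : ℝ}
    (hd : DifferentiableOn ℂ ψ (Metric.ball c R)) (hm : MapsTo ψ (Metric.ball c R) unitDisk)
    (hw : w ∈ Metric.ball c R) : ‖diskMobius (ψ c) (ψ w)‖ ≤ dist w c / R := by
  have hR : 0 < R := dist_nonneg.trans_lt hw
  have hc := hm (Metric.mem_ball_self hR)
  have h1 : DifferentiableOn ℂ (fun z => diskMobius (ψ c) (ψ z)) (Metric.ball c R) :=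
    (differentiableOn_diskMobius hc).comp hd hm
  have h2 : diskMobius (ψ c) (ψ c) = 0 := by simp [diskMobius]
  have h3 : MapsTo (fun z => diskMobius (ψ c) (ψ z)) (Metric.ball c R)
      (Metric.ball (diskMobius (ψ c) (ψ c)) 1) := by
    intro z hz
    rw [h2, mem_ball_zero_iff]
    exact norm_diskMobius_lt_one hc (hm hz)
  have := Complex.dist_le_div_mul_dist_of_mapsTo_ball h1 (h3.mono_right Metric.ball_subset_closedBall) hw
  simp only [h2, dist_zero_right] at this
  rw [div_eq_mul_one_div]
  linarith

/-- The Schwarz–Pick lemma. -/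
theorem norm_diskMobius_map_le {ψ : ℂ → ℂ} (hd : DifferentiableOn ℂ ψ unitDisk)
    (hm : MapsTo ψ unitDisk unitDisk) {a z : ℂ} (ha : a ∈ unitDisk) (hz : z ∈ unitDisk) :
    ‖diskMobius (ψ a) (ψ z)‖ ≤ ‖diskMobius a z‖ := by
  have hna : ‖-a‖ < 1 := by simpa [unitDisk] using ha
  have hmap : MapsTo (diskMobius (-a)) unitDisk unitDisk :=
    fun x hx => norm_diskMobius_lt_one hna hx
  have h0 : diskMobius (-a) 0 = a := by simp [diskMobius]
  have hd' := hd.comp (differentiableOn_diskMobius hna) hmap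
  have hm' := hm.comp hmap
  have := norm_diskMobius_le_div (c := 0) (R := 1) (w := diskMobius a z)
    (by rwa [← unitDisk_eq_ball]) (by rwa [← unitDisk_eq_ball])
    (by rw [← unitDisk_eq_ball]; exact norm_diskMobius_lt_one ha hz)
  simpa [h0, diskMobius_neg_diskMobius ha hz] using this

theorem schwarzPick_norm {ψ : ℂ → ℂ} (hd : DifferentiableOn ℂ ψ unitDisk)
    (hm : MapsTo ψ unitDisk unitDisk) {a z : ℂ} (ha : a ∈ unitDisk) (hz : z ∈ unitDisk) :
    (1 - ‖a‖ ^ 2) * (1 - ‖z‖ ^ 2) / ‖1 - (starRingEnd ℂ) a * z‖ ^ 2 ≤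
      (1 - ‖ψ a‖ ^ 2) * (1 - ‖ψ z‖ ^ 2) / ‖1 - (starRingEnd ℂ) (ψ a) * ψ z‖ ^ 2 := by
  rw [← one_sub_norm_diskMobius_sq ha hz, ← one_sub_norm_diskMobius_sq (hm ha) (hm hz)]
  have := norm_diskMobius_map_le hd hm ha hz
  gcongr

/-- If `b` is within pseudohyperbolic distance `ρ < 1` of `a`, then the distances of `a` and `b`
from the unit circle are comparable. -/
theorem dist_circle_le_of_diskMobius {a b : ℂ} (ha : ‖a‖ < 1) (hb : ‖b‖ < 1)
    {ρ : ℝ} (hρ : ‖diskMobius a b‖ = ρ) :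
    1 - ‖b‖ ^ 2 ≤ (1 + 2 * ρ / (1 - ρ)) * (1 - ‖a‖ ^ 2) ∧ ‖b - a‖ ≤ 2 * ρ := by
  have hρ1 : ρ < 1 := hρ ▸ norm_diskMobius_lt_one ha hb
  have hρ0 : 0 ≤ ρ := hρ ▸ norm_nonneg _
  have h0 : 0 < ‖1 - (starRingEnd ℂ) a * b‖ :=
    norm_pos_iff.2 (one_sub_conj_mul_ne_zero ha.le hb)
  have h1 : ‖b - a‖ = ρ * ‖1 - (starRingEnd ℂ) a * b‖ := by
    rw [← hρ, diskMobius, norm_div, div_mul_cancel₀ _ h0.ne']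
  have h2 : ‖1 - (starRingEnd ℂ) a * b‖ ≤ 2 := by
    refine (norm_sub_le _ _).trans ?_
    rw [norm_one, norm_mul, RCLike.norm_conj]
    nlinarith [norm_nonneg a, norm_nonneg b]
  have h3 : ‖1 - (starRingEnd ℂ) a * b‖ ≤ (1 - ‖a‖ ^ 2) + ‖b - a‖ := by
    have e : 1 - (starRingEnd ℂ) a * b
        = ((1 - ‖a‖ ^ 2 : ℝ) : ℂ) - (starRingEnd ℂ) a * (b - a) := by
      have : (starRingEnd ℂ) a * a = ((‖a‖ ^ 2 : ℝ) : ℂ) := by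
        rw [mul_comm, Complex.mul_conj, Complex.normSq_eq_norm_sq]
      push_cast at this ⊢
      rw [← this]; ring
    rw [e]
    refine (norm_sub_le _ _).trans ?_
    rw [Complex.norm_real, norm_mul, RCLike.norm_conj, Real.norm_of_nonneg]
    · nlinarith [norm_nonneg (b - a)]
    · nlinarith [norm_nonneg a]
  refine ⟨?_, by rw [h1]; nlinarith⟩
  -- Substitute `h3` into `h1` and solve for `‖b - a‖`, which is possible because `ρ < 1`.
  have h4 : (1 - ρ) * ‖b - a‖ ≤ ρ * (1 - ‖a‖ ^ 2) := by nlinarith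
  have h5 : ‖a‖ ≤ ‖b‖ + ‖b - a‖ := by
    have := norm_sub_norm_le a b
    rw [norm_sub_rev] at this; linarith
  have h6 : ‖b - a‖ ≤ ρ / (1 - ρ) * (1 - ‖a‖ ^ 2) := by
    rw [div_mul_eq_mul_div, le_div_iff₀ (by linarith)]; linarith
  have h7 : ‖a‖ ^ 2 - ‖b‖ ^ 2 ≤ 2 * ‖b - a‖ := by
    nlinarith [norm_nonneg a, norm_nonneg b, norm_nonneg (b - a)]
  have : 2 * ρ / (1 - ρ) = 2 * (ρ / (1 - ρ)) := by ring
  rw [this]; nlinarith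

/-! ### Horodisks and semigroups of self-maps of the disk. -/

theorem norm_one_sub_conj_mul_of_norm_eq_one {σ : ℂ} (hσ : ‖σ‖ = 1) (z : ℂ) :
    ‖1 - (starRingEnd ℂ) σ * z‖ = ‖σ - z‖ := by
  have h1 : (starRingEnd ℂ) σ * σ = 1 := by
    rw [mul_comm, Complex.mul_conj, Complex.normSq_eq_norm_sq, hσ]; simp
  have h2 : 1 - (starRingEnd ℂ) σ * z = (starRingEnd ℂ) σ * (σ - z) := by rw [mul_sub, h1]
  rw [h2, norm_mul, RCLike.norm_conj, hσ, one_mul]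

/-- A version of the Julia–Wolff lemma: a holomorphic self-map of the disk which asymptotically
fixes, in the hyperbolic metric, a sequence tending to `σ` preserves the horodisks at `σ`. -/
theorem horodisk_le_of_tendsto {ψ : ℂ → ℂ} (hd : DifferentiableOn ℂ ψ unitDisk)
    (hm : MapsTo ψ unitDisk unitDisk) {σ : ℂ} (hσ : ‖σ‖ = 1) {a : ℕ → ℂ}
    (ha : ∀ n, a n ∈ unitDisk) (hlim : Tendsto a atTop (𝓝 σ))
    (hρ : Tendsto (fun n => ‖diskMobius (a n) (ψ (a n))‖) atTop (𝓝 0))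
    {z : ℂ} (hz : z ∈ unitDisk) :
    (1 - ‖z‖ ^ 2) / ‖σ - z‖ ^ 2 ≤ (1 - ‖ψ z‖ ^ 2) / ‖σ - ψ z‖ ^ 2 := by
  have hb : Tendsto (fun n => ψ (a n)) atTop (𝓝 σ) := by
    have h1 : Tendsto (fun n => ψ (a n) - a n) atTop (𝓝 0) := by
      refine squeeze_zero_norm (fun n => (dist_circle_le_of_diskMobius (ha n) (hm (ha n)) rfl).2) ?_
      simpa using hρ.const_mul 2
    simpa using h1.add hlim
  have hne : ∀ w ∈ unitDisk, ‖1 - (starRingEnd ℂ) σ * w‖ ^ 2 ≠ 0 := fun w hw =>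
    pow_ne_zero _ (norm_ne_zero_iff.2 (one_sub_conj_mul_ne_zero hσ.le hw))
  have hden : ∀ (w : ℂ) (b : ℕ → ℂ), Tendsto b atTop (𝓝 σ) →
      Tendsto (fun n => ‖1 - (starRingEnd ℂ) (b n) * w‖ ^ 2) atTop
        (𝓝 (‖1 - (starRingEnd ℂ) σ * w‖ ^ 2)) := by
    intro w b hb
    exact ((tendsto_const_nhds.sub
      (((Complex.continuous_conj.tendsto σ).comp hb).mul_const w)).norm).pow 2
  have hL : Tendsto (fun n => (1 - ‖z‖ ^ 2) / ‖1 - (starRingEnd ℂ) (a n) * z‖ ^ 2) atTop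
      (𝓝 ((1 - ‖z‖ ^ 2) / ‖1 - (starRingEnd ℂ) σ * z‖ ^ 2)) :=
    tendsto_const_nhds.div (hden z a hlim) (hne z hz)
  have hR : Tendsto (fun n => (1 + 2 * ‖diskMobius (a n) (ψ (a n))‖ /
      (1 - ‖diskMobius (a n) (ψ (a n))‖)) *
      ((1 - ‖ψ z‖ ^ 2) / ‖1 - (starRingEnd ℂ) (ψ (a n)) * ψ z‖ ^ 2)) atTop
      (𝓝 ((1 + 2 * 0 / (1 - 0)) * ((1 - ‖ψ z‖ ^ 2) / ‖1 - (starRingEnd ℂ) σ * ψ z‖ ^ 2))) :=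
    (tendsto_const_nhds.add ((hρ.const_mul 2).div (tendsto_const_nhds.sub hρ) (by norm_num))).mul
      (tendsto_const_nhds.div (hden _ _ hb) (hne _ (hm hz)))
  -- Schwarz–Pick for the pair `a n`, `z`, divided by `1 - ‖a n‖ ^ 2`. The ratio of `1 - ‖ψ (a n)‖ ^
  -- 2` to this is at most a factor tending to `1`.
  have := le_of_tendsto_of_tendsto' hL hR fun n => by
    have hA : 0 < 1 - ‖a n‖ ^ 2 := by
      have h1 : ‖a n‖ < 1 := ha n
      nlinarith [norm_nonneg (a n)]
    have hz' : 0 < 1 - ‖ψ z‖ ^ 2 := by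
      have h1 : ‖ψ z‖ < 1 := hm hz
      nlinarith [norm_nonneg (ψ z)]
    have h1 := schwarzPick_norm hd hm (ha n) hz
    have h2 := (dist_circle_le_of_diskMobius (ha n) (hm (ha n)) rfl).1
    rw [← mul_le_mul_iff_right₀ hA]
    calc _ = (1 - ‖a n‖ ^ 2) * (1 - ‖z‖ ^ 2) / ‖1 - (starRingEnd ℂ) (a n) * z‖ ^ 2 := by ring
      _ ≤ _ := h1
      _ = (1 - ‖ψ (a n)‖ ^ 2) *
          ((1 - ‖ψ z‖ ^ 2) / ‖1 - (starRingEnd ℂ) (ψ (a n)) * ψ z‖ ^ 2) := by ring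
      _ ≤ _ := by
        refine (mul_le_mul_of_nonneg_right h2 (by positivity)).trans_eq ?_
        ring
  simpa [norm_one_sub_conj_mul_of_norm_eq_one hσ] using this

/-- An accumulation point inside the disk would be sent by `h` to a finite limit of the unbounded
sequence. -/
theorem exists_subseq_tendsto_circle {h g : ℂ → ℂ} (hd : DifferentiableOn ℂ h unitDisk)
    (hg : ∀ z ∈ unitDisk, g (h z) = z) {w : ℕ → ℂ} (hw : ∀ n, w n ∈ h '' unitDisk)
    (hlim : Tendsto (fun n => ‖w n‖) atTop atTop) :
    ∃ σ : ℂ, ‖σ‖ = 1 ∧ ∃ φ : ℕ → ℕ, StrictMono φ ∧ Tendsto (fun n => g (w (φ n))) atTop (𝓝 σ) := by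
  have hmem : ∀ n, g (w n) ∈ unitDisk ∧ h (g (w n)) = w n := by
    intro n
    obtain ⟨z, hz, hzw⟩ := hw n
    rw [← hzw, hg z hz]
    exact ⟨hz, rfl⟩
  obtain ⟨σ, hσ, φ, hφ, hφl⟩ := (isCompact_closedBall (0 : ℂ) 1).tendsto_subseq
    (x := fun n => g (w n)) fun n => by
      have h1 : ‖g (w n)‖ < 1 := (hmem n).1
      simpa using h1.le
  refine ⟨σ, ?_, φ, hφ, hφl⟩
  have hσ1 : ‖σ‖ ≤ 1 := by simpa using hσ
  refine hσ1.antisymm (not_lt.1 fun hlt => ?_)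
  have h1 : Tendsto (fun n => h (g (w (φ n)))) atTop (𝓝 (h σ)) :=
    ((hd.differentiableAt (isOpen_unitDisk.mem_nhds hlt)).continuousAt.tendsto).comp hφl
  simp only [fun n => (hmem (φ n)).2] at h1
  exact not_tendsto_nhds_of_tendsto_atTop (hlim.comp hφ.tendsto_atTop) _ h1.norm

/-- Horodisks at `σ` become half-planes, so the horodisk inequality can be differentiated as a
statement about a real part. -/
theorem re_add_div_sub {σ : ℂ} (hσ : ‖σ‖ = 1) {z : ℂ} (hz : σ ≠ z) :
    ((σ + z) / (σ - z)).re = (1 - ‖z‖ ^ 2) / ‖σ - z‖ ^ 2 := by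
  have h0 : Complex.normSq (σ - z) ≠ 0 := by simpa [sub_eq_zero] using hz
  have h1 : Complex.normSq σ = 1 := by rw [Complex.normSq_eq_norm_sq, hσ]; simp
  rw [← Complex.normSq_eq_norm_sq, ← Complex.normSq_eq_norm_sq, Complex.div_re, ← h1, ← add_div]
  congr 1
  simp [Complex.normSq_apply]
  ring

theorem HasDerivAt.nonneg_of_forall_gt_le {Q : ℝ → ℝ} {q x : ℝ} (hQ : HasDerivAt Q q x)
    (hle : ∀ t, x < t → Q x ≤ Q t) : 0 ≤ q := by
  have h1 : Tendsto (slope Q x) (𝓝[>] x) (𝓝 q) := (hasDerivAt_iff_tendsto_slope.1 hQ).mono_left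
    (nhdsWithin_mono x (fun t (ht : x < t) => ht.ne'))
  refine ge_of_tendsto h1 ?_
  filter_upwards [self_mem_nhdsWithin] with t ht
  rw [slope_def_field]
  exact div_nonneg (sub_nonneg.2 (hle t ht)) (sub_nonneg.2 (le_of_lt ht))

/-- If the image of `h` is invariant under the translations by `-t u`, `t ≥ 0`, and contains
arbitrarily large disks whose centres have preimages tending to the boundary point `σ`,
then the semigroup `h⁻¹ ∘ (h - t u)` fixes `σ`, which restricts the argument of `h'`. -/
theorem re_conj_mul_deriv_nonneg {h g : ℂ → ℂ} (hd : DifferentiableOn ℂ h unitDisk)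
    (hopen : IsOpen (h '' unitDisk)) (hder : ∀ z ∈ unitDisk, deriv h z ≠ 0)
    (hg : ∀ z ∈ unitDisk, g (h z) = z) (hgd : DifferentiableOn ℂ g (h '' unitDisk))
    {w : ℕ → ℂ} {r : ℕ → ℝ} (hball : ∀ n, Metric.ball (w n) (r n) ⊆ h '' unitDisk)
    (hr0 : ∀ n, 0 < r n)
    (hr : Tendsto r atTop atTop) {σ : ℂ} (hσ : ‖σ‖ = 1)
    (hlim : Tendsto (fun n => g (w n)) atTop (𝓝 σ)) {u : ℂ}
    (hu : ∀ z ∈ unitDisk, ∀ t : ℝ, 0 ≤ t → h z - t * u ∈ h '' unitDisk)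
    {z : ℂ} (hz : z ∈ unitDisk) :
    0 ≤ ((starRingEnd ℂ) u * -(deriv h z * (σ - z) ^ 2 * (starRingEnd ℂ) σ)).re := by
  have hmaps : MapsTo g (h '' unitDisk) unitDisk := by
    rintro _ ⟨x, hx, rfl⟩
    rwa [hg x hx]
  have hright : ∀ y ∈ h '' unitDisk, h (g y) = y := by
    rintro _ ⟨x, hx, rfl⟩
    rw [hg x hx]
  have hσne : ∀ x ∈ unitDisk, σ ≠ x := by
    rintro x hx rfl
    have hx' : ‖σ‖ < 1 := hx
    linarith
  have hwm : ∀ n, w n ∈ h '' unitDisk := fun n => hball n (Metric.mem_ball_self (hr0 n))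
  have key : ∀ t : ℝ, 0 ≤ t → (1 - ‖z‖ ^ 2) / ‖σ - z‖ ^ 2 ≤
      (1 - ‖g (h z - t * u)‖ ^ 2) / ‖σ - g (h z - t * u)‖ ^ 2 := by
    intro t ht
    refine horodisk_le_of_tendsto (ψ := fun x => g (h x - t * u)) (a := fun n => g (w n))
      (hgd.comp (hd.sub_const _) fun x hx => hu x hx t ht) (fun x hx => hmaps (hu x hx t ht)) hσ
      (fun n => hmaps (hwm n)) hlim ?_ hz
    -- The translation by `t * u` is small compared with the radius `r n`, so Schwarz–Pick for `g`
    -- on that disk bounds the pseudohyperbolic displacement of `g (w n)`.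
    refine squeeze_zero' (Eventually.of_forall fun n => norm_nonneg _) (g := fun n => ‖t * u‖ / r n)
      ?_ (hr.const_div_atTop _)
    filter_upwards [hr.eventually_gt_atTop ‖t * u‖] with n hn
    simp only [hright _ (hwm n)]
    have := norm_diskMobius_le_div (ψ := g) (c := w n) (R := r n) (w := w n - t * u)
      (hgd.mono (hball n)) (hmaps.mono_left (hball n)) (by simpa [dist_eq_norm] using hn)
    simpa [dist_eq_norm] using this
  have hz' := hder z hz
  have hσz : σ - z ≠ 0 := sub_ne_zero.2 (hσne z hz)
  have hgz : HasDerivAt g (deriv h z)⁻¹ (h z) := by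
    have h1 := (hgd.differentiableAt (hopen.mem_nhds ⟨z, hz, rfl⟩)).hasDerivAt
    have h2 := h1.comp z (hd.differentiableAt (isOpen_unitDisk.mem_nhds hz)).hasDerivAt
    have h3 : HasDerivAt (g ∘ h) 1 z := by
      refine (hasDerivAt_id z).congr_of_eventuallyEq ?_
      filter_upwards [isOpen_unitDisk.mem_nhds hz] with x hx using hg x hx
    rw [← eq_inv_of_mul_eq_one_left (h2.unique h3)]
    exact h1
  have hp : HasDerivAt (fun t : ℝ => g (h z - t * u)) ((deriv h z)⁻¹ * -u) 0 := by
    have h1 : HasDerivAt (fun t : ℝ => h z - t * u) (-u) 0 := by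
      simpa using ((Complex.ofRealCLM.hasDerivAt (x := 0)).mul_const u).const_sub (h z)
    exact HasDerivAt.comp (h := fun t : ℝ => h z - t * u) (h₂ := g) 0 (by simpa using hgz) h1
  have hp0 : g (h z - (0 : ℝ) * u) = z := by simp [hg z hz]
  have hq := ((hp.const_add σ).fun_div (hp.const_sub σ) (by rwa [hp0]))
  -- The real part of the Cayley transform of the orbit is never below its initial value. Its
  -- derivative at `0` is `2 * Re (u / N)`, which has the sign of `Re (conj u * N)`.
  have hQ := (Complex.reCLM.hasFDerivAt.comp_hasDerivAt (0 : ℝ) hq).nonneg_of_forall_gt_le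
    fun t ht => by
      have h1 := key t ht.le
      have h2 : g (h z - t * u) ∈ unitDisk := hmaps (hu z hz t ht.le)
      simp only [Function.comp_apply, Complex.reCLM_apply]
      rw [hp0, re_add_div_sub hσ (hσne z hz), re_add_div_sub hσ (hσne _ h2)]
      exact h1
  rw [hp0] at hQ
  have hσσ : (starRingEnd ℂ) σ * σ = 1 := by
    rw [mul_comm, Complex.mul_conj, Complex.normSq_eq_norm_sq, hσ]; simp
  have hσ0 : (starRingEnd ℂ) σ ≠ 0 := left_ne_zero_of_mul (hσσ ▸ one_ne_zero)
  set N := -(deriv h z * (σ - z) ^ 2 * (starRingEnd ℂ) σ) with hN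
  have hN0 : N ≠ 0 := by simp [hN, hz', hσz, hσ0]
  have e : ((deriv h z)⁻¹ * -u * (σ - z) - (σ + z) * -((deriv h z)⁻¹ * -u)) / (σ - z) ^ 2
      = 2 * (u / N) := by
    rw [hN]
    field_simp
    linear_combination (-2 * u) * hσσ
  rw [Complex.reCLM_apply, e] at hQ
  have h5 : ((starRingEnd ℂ) u * N).re = (u / N).re * Complex.normSq N := by
    have : Complex.normSq N ≠ 0 := by simpa using hN0
    rw [Complex.div_re]
    field_simp
    simp
  rw [h5]
  have : (2 * (u / N)).re = 2 * (u / N).re := by simp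
  exact mul_nonneg (by linarith) (Complex.normSq_nonneg _)

/-! ### Recession cones and the opening angle at infinity. -/

/-- The directions in which the set `K` recedes to infinity. -/
def recessionCone (K : Set ℂ) : Set ℂ := {u | ∀ k ∈ K, ∀ t : ℝ, 0 ≤ t → k + t * u ∈ K}

theorem isClosed_recessionCone {K : Set ℂ} (hK : IsClosed K) : IsClosed (recessionCone K) := by
  have : recessionCone K = ⋂ k ∈ K, ⋂ t : ℝ, ⋂ _ : 0 ≤ t, {u | k + t * u ∈ K} := by
    ext u; simp [recessionCone]
  rw [this]
  refine isClosed_biInter fun k _ => isClosed_iInter fun t => isClosed_iInter fun _ => ?_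
  exact hK.preimage (by fun_prop)

theorem add_mem_recessionCone {K : Set ℂ} {u v : ℂ} (hu : u ∈ recessionCone K)
    (hv : v ∈ recessionCone K) {a b : ℝ} (ha : 0 ≤ a) (hb : 0 ≤ b) :
    a * u + b * v ∈ recessionCone K := by
  intro k hk t ht
  have := hv _ (hu k hk (t * a) (by positivity)) (t * b) (by positivity)
  convert this using 1
  push_cast
  ring

/-- The points `(1 - t/n) k + (t/n) (n u)` of the segments from `k` to `n u` converge to `k + t u`.
-/
theorem mem_recessionCone_of_frequently {K : Set ℂ} (hK : IsClosed K) (hc : Convex ℝ K) {u : ℂ}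
    (hu : ∃ᶠ n : ℕ in atTop, (n : ℂ) * u ∈ K) : u ∈ recessionCone K := by
  intro k hk t ht
  have hlim : Tendsto (fun n : ℕ => (1 - ((t / n : ℝ) : ℂ)) * k + t * u) atTop
      (𝓝 ((1 - ((0 : ℝ) : ℂ)) * k + t * u)) := by
    have h1 : Tendsto (fun n : ℕ => t / (n : ℝ)) atTop (𝓝 0) := tendsto_const_div_atTop_nhds_zero_nat t
    have h2 := (Complex.continuous_ofReal.tendsto 0).comp h1
    exact ((tendsto_const_nhds.sub h2).mul_const k).add_const _
  simp only [ofReal_zero, sub_zero, one_mul] at hlim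
  refine hK.mem_of_frequently_of_tendsto ?_ hlim
  refine (hu.and_eventually (eventually_gt_atTop ⌈t⌉₊)).mono fun n hn => ?_
  have htn : t < n := Nat.lt_of_ceil_lt hn.2
  have hn0 : (0 : ℝ) < n := ht.trans_lt htn
  have := hc hk hn.1 (a := 1 - t / n) (b := t / n)
    (by rw [sub_nonneg, div_le_one hn0]; exact htn.le) (by positivity) (by ring)
  convert this using 1
  simp only [Complex.real_smul]
  have : (n : ℂ) ≠ 0 := by exact_mod_cast hn0.ne'
  push_cast
  field_simp

/-- The sine rule writes `exp (t * I)` as a nonnegative combination of the two extreme directions;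
`b - a < π` makes the denominator positive. -/
theorem exp_mem_recessionCone_of_mem_Icc {K : Set ℂ} {a b t : ℝ}
    (ha : exp (a * I) ∈ recessionCone K) (hb : exp (b * I) ∈ recessionCone K)
    (hab : b - a < Real.pi) (ht : t ∈ Icc a b) : exp (t * I) ∈ recessionCone K := by
  obtain ⟨hat, htb⟩ := ht
  rcases hat.eq_or_lt with rfl | hat
  · exact ha
  have hs : 0 < Real.sin (b - a) := Real.sin_pos_of_pos_of_lt_pi (by linarith) hab
  have := add_mem_recessionCone ha hb (a := Real.sin (b - t) / Real.sin (b - a))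
    (b := Real.sin (t - a) / Real.sin (b - a))
    (div_nonneg (Real.sin_nonneg_of_nonneg_of_le_pi (by linarith) (by linarith)) hs.le)
    (div_nonneg (Real.sin_nonneg_of_nonneg_of_le_pi (by linarith) (by linarith)) hs.le)
  convert this using 1
  have h0 : Real.sin b * Real.cos a - Real.cos b * Real.sin a ≠ 0 := by
    rw [← Real.sin_sub]; exact hs.ne'
  rw [exp_mul_I, exp_mul_I, exp_mul_I, Real.sin_sub, Real.sin_sub, Real.sin_sub]
  apply Complex.ext
  · simp only [← ofReal_cos, ← ofReal_sin, add_re, mul_re, ofReal_re, ofReal_im, I_re, I_im,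
      add_im, mul_im]
    field_simp
    ring
  · simp only [← ofReal_cos, ← ofReal_sin, add_re, mul_re, ofReal_re, ofReal_im, I_re, I_im,
      add_im, mul_im]
    field_simp
    ring

open MeasureTheory in
/-- The complement of the opening angle at infinity is bounded below by the angle of the recession
cone. -/
theorem le_volume_recession_directions {Ω : Set ℂ} (hΩ : IsOpen Ω) (hc : Convex ℝ Ωᶜ) {α : ℝ}
    (hα0 : 0 ≤ α) (hα : openingAngleAtInfty Ω ≤ ENNReal.ofReal (Real.pi * α)) :
    ENNReal.ofReal (2 * Real.pi - Real.pi * α) ≤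
      volume ({t : ℝ | exp (t * I) ∈ recessionCone Ωᶜ} ∩ Ioc (-Real.pi) Real.pi) := by
  set T : ℝ → Set ℝ := fun R => {t : ℝ | t ∈ Ioc (-Real.pi) Real.pi ∧ (R : ℂ) * exp (t * I) ∈ Ω}
  -- Directions that stay in `Ω` at all integer radii from `N` on. These sets increase with `N`, and
  -- each is contained in `T n` for arbitrarily large `n`, so the upper limit bounds the measure of
  -- their union.
  set B : ℕ → Set ℝ := fun N => ⋂ n ≥ N, T n
  have hB : volume (⋃ N, B N) ≤ ENNReal.ofReal (Real.pi * α) := by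
    have hmono : Monotone B := by
      intro N M hNM t ht
      simp only [B, mem_iInter] at ht ⊢
      exact fun n hn => ht n (hNM.trans hn)
    rw [hmono.measure_iUnion]
    refine iSup_le fun N => le_trans ?_ hα
    refine le_limsup_of_frequently_le ?_
    rw [frequently_atTop]
    intro R
    refine ⟨(max N ⌈R⌉₊ : ℕ), ?_, ?_⟩
    · exact (Nat.le_ceil R).trans (by exact_mod_cast le_max_right _ _)
    · refine measure_mono (μ := volume) fun t ht => ?_
      simp only [B, mem_iInter] at ht
      exact ht _ (le_max_left _ _)
  have hsub : Ioc (-Real.pi) Real.pi ⊆ (⋃ N, B N) ∪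
      ({t : ℝ | exp (t * I) ∈ recessionCone Ωᶜ} ∩ Ioc (-Real.pi) Real.pi) := by
    intro t ht
    by_cases hev : ∀ᶠ n : ℕ in atTop, (n : ℂ) * exp (t * I) ∈ Ω
    · obtain ⟨N, hN⟩ := eventually_atTop.1 hev
      refine Or.inl (mem_iUnion.2 ⟨N, ?_⟩)
      simp only [B, mem_iInter]
      exact fun n hn => ⟨ht, by simpa using hN n hn⟩
    · refine Or.inr ⟨mem_recessionCone_of_frequently hΩ.isClosed_compl hc ?_, ht⟩
      exact not_eventually.1 hev
  have h2 := (measure_mono (μ := volume) hsub).trans (measure_union_le _ _)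
  rw [Real.volume_Ioc] at h2
  have h3 := h2.trans (add_le_add_left hB _)
  rw [show Real.pi - -Real.pi = 2 * Real.pi by ring] at h3
  rw [ENNReal.ofReal_sub _ (by positivity)]
  exact tsub_le_iff_left.2 h3

theorem exists_unit_vector_re_pos {K : Set ℂ} (hK : IsClosed K) (hc : Convex ℝ K)
    (hne : K.Nonempty) (h0 : (0 : ℂ) ∉ K) :
    ∃ v : ℂ, ‖v‖ = 1 ∧ ∀ k ∈ K, 0 < ((starRingEnd ℂ) v * k).re := by
  obtain ⟨f, s, hs, hf⟩ := geometric_hahn_banach_point_closed hc hK h0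
  rw [map_zero] at hs
  set v : ℂ := ⟨f 1, f I⟩
  have hv : ∀ z : ℂ, ((starRingEnd ℂ) v * z).re = f z := by
    intro z
    conv_rhs => rw [show z = z.re • (1 : ℂ) + z.im • I by simp]
    rw [map_add, map_smul, map_smul]
    simp [v]
    ring
  have hv0 : v ≠ 0 := by
    intro hv0
    obtain ⟨k, hk⟩ := hne
    have h1 := hv k
    have h2 := hf k hk
    rw [hv0] at h1
    simp at h1
    linarith
  refine ⟨(‖v‖⁻¹ : ℝ) * v, ?_, fun k hk => ?_⟩
  · rw [norm_mul, Complex.norm_real, norm_inv, norm_norm, inv_mul_cancel₀ (norm_ne_zero_iff.2 hv0)]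
  · rw [map_mul, Complex.conj_ofReal, mul_assoc, Complex.re_ofReal_mul, hv]
    exact mul_pos (inv_pos.2 (norm_pos_iff.2 hv0)) (hs.trans (hf k hk))

-- As the complement lies in a half-plane, its recession directions are within `π/2` of `γ₀`. Up to
-- two endpoints they fill an interval of length at least `2δ`, whose midpoint serves as `γ`.
open MeasureTheory in
theorem exists_sector_subset_recessionCone {Ω : Set ℂ} (hΩ : IsOpen Ω)
    {γ₀ δ : ℝ} (hδ : 0 < δ) (hpos : ∀ k ∈ Ωᶜ, 0 < ((starRingEnd ℂ) (exp (γ₀ * I)) * k).re)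
    (hne : Ωᶜ.Nonempty)
    (hvol : ENNReal.ofReal (2 * δ) ≤
      volume ({t : ℝ | exp (t * I) ∈ recessionCone Ωᶜ} ∩ Ioc (-Real.pi) Real.pi)) :
    ∃ γ : ℝ, exp ((γ + δ : ℝ) * I) ∈ recessionCone Ωᶜ ∧
      exp ((γ - δ : ℝ) * I) ∈ recessionCone Ωᶜ := by
  set S : Set ℝ := {t : ℝ | exp (t * I) ∈ recessionCone Ωᶜ} with hS
  have hSc : IsClosed S :=
    (isClosed_recessionCone hΩ.isClosed_compl).preimage (by fun_prop)
  have hcos : ∀ t ∈ S, 0 ≤ Real.cos (t - γ₀) := by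
    intro t ht
    by_contra! hlt
    obtain ⟨k, hk⟩ := hne
    set A := ((starRingEnd ℂ) (exp (γ₀ * I)) * k).re
    have hA : 0 < A := hpos k hk
    -- This time brings the ray to the boundary line of the half-plane, where strict positivity
    -- fails.
    have h1 := hpos _ (ht k hk (A / -Real.cos (t - γ₀)) (div_nonneg hA.le (by linarith)))
    have h2 : (starRingEnd ℂ) (exp (γ₀ * I)) * exp (t * I) = exp ((t - γ₀ : ℝ) * I) := by
      rw [← Complex.exp_conj, ← Complex.exp_add]
      congr 1
      simp
      ring
    rw [mul_add, mul_left_comm, h2, add_re, Complex.re_ofReal_mul, Complex.exp_ofReal_mul_I_re] at h1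
    have h3 : A / -Real.cos (t - γ₀) * Real.cos (t - γ₀) = -A := by
      rw [div_neg, neg_mul, div_mul_cancel₀ _ hlt.ne]
    rw [h3] at h1
    linarith
  -- An open interval of length `π`, so that any two of its angles differ by less than `π`; the two
  -- angles lost are a null set.
  set E : Set ℝ := S ∩ Ioo (γ₀ - Real.pi / 2) (γ₀ + Real.pi / 2) with hE
  have hper : ∀ (g : AddSubgroup.zmultiples (2 * Real.pi)), (fun x => g +ᵥ x) ⁻¹' S = S := by
    rintro ⟨g, hg⟩
    obtain ⟨n, rfl⟩ := AddSubgroup.mem_zmultiples_iff.1 hg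
    ext t
    have : exp (((n • (2 * Real.pi) + t : ℝ) : ℂ) * I) = exp (t * I) := by
      rw [Complex.exp_eq_exp_iff_exists_int]
      exact ⟨n, by push_cast; simp; ring⟩
    simp only [hS, mem_preimage, mem_ofPred_eq, AddSubgroup.vadd_def, vadd_eq_add]
    rw [this]
  have hshift : volume (S ∩ Ioc (-Real.pi) Real.pi) =
      volume (S ∩ Ioc (γ₀ - Real.pi) (γ₀ + Real.pi)) := by
    have h1 := isAddFundamentalDomain_Ioc Real.two_pi_pos (-Real.pi) volume
    have h2 := isAddFundamentalDomain_Ioc Real.two_pi_pos (γ₀ - Real.pi) volume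
    have := h1.measure_set_eq h2 hSc.measurableSet hper
    rwa [show -Real.pi + 2 * Real.pi = Real.pi by ring,
      show γ₀ - Real.pi + 2 * Real.pi = γ₀ + Real.pi by ring] at this
  have hEvol : ENNReal.ofReal (2 * δ) ≤ volume E := by
    rw [hshift] at hvol
    have hsub : S ∩ Ioc (γ₀ - Real.pi) (γ₀ + Real.pi) ⊆
        E ∪ {γ₀ - Real.pi / 2, γ₀ + Real.pi / 2} := by
      rintro t ⟨htS, ht1, ht2⟩
      have hct := hcos t htS
      have hle1 : γ₀ - Real.pi / 2 ≤ t := by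
        by_contra! hlt
        have : Real.cos (-(t - γ₀)) < 0 :=
          Real.cos_neg_of_pi_div_two_lt_of_lt (by linarith) (by linarith [Real.pi_pos])
        rw [Real.cos_neg] at this
        linarith
      have hle2 : t ≤ γ₀ + Real.pi / 2 := by
        by_contra! hlt
        have := Real.cos_neg_of_pi_div_two_lt_of_lt (x := t - γ₀) (by linarith)
          (by linarith [Real.pi_pos])
        linarith
      rcases hle1.eq_or_lt with h | h
      · exact Or.inr (Or.inl h.symm)
      rcases hle2.eq_or_lt with h' | h'
      · exact Or.inr (Or.inr h')
      exact Or.inl ⟨htS, h, h'⟩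
    refine (hvol.trans (measure_mono hsub)).trans ((measure_union_le _ _).trans ?_)
    rw [((Set.finite_singleton _).insert _).measure_zero volume, add_zero]
  have hEne : E.Nonempty := by
    by_contra h
    rw [not_nonempty_iff_eq_empty] at h
    rw [h, measure_empty] at hEvol
    simp at hEvol
    linarith
  have hEb : BddBelow E := ⟨γ₀ - Real.pi / 2, fun t ht => ht.2.1.le⟩
  have hEa : BddAbove E := ⟨γ₀ + Real.pi / 2, fun t ht => ht.2.2.le⟩
  set a := sInf E
  set b := sSup E
  have hab : 2 * δ ≤ b - a := by
    have h1 : E ⊆ Icc a b := fun t ht => ⟨csInf_le hEb ht, le_csSup hEa ht⟩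
    have h2 := hEvol.trans (measure_mono h1)
    rw [Real.volume_Icc] at h2
    rcases ENNReal.ofReal_le_ofReal_iff'.1 h2 with h | h
    · exact h
    · linarith
  have hIoo : Ioo a b ⊆ S := by
    intro t ht
    obtain ⟨x, hx, hxt⟩ := exists_lt_of_csInf_lt hEne ht.1
    obtain ⟨y, hy, hty⟩ := exists_lt_of_lt_csSup hEne ht.2
    exact exp_mem_recessionCone_of_mem_Icc hx.1 hy.1 (by linarith [hx.2.1, hy.2.2])
      ⟨hxt.le, hty.le⟩
  have hIcc : Icc a b ⊆ S := by
    rw [← closure_Ioo (by linarith : a < b).ne]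
    exact hSc.closure_subset_iff.2 hIoo
  exact ⟨(a + b) / 2, hIcc ⟨by linarith, by linarith⟩, hIcc ⟨by linarith, by linarith⟩⟩

/-- For `A ≠ 0` the hypotheses say `|arg A| ≤ π/2 - δ`, whence `cos (arg A) ≥ sin δ`. -/
theorem sin_mul_norm_le_re {δ : ℝ} (h0 : 0 < δ) (h1 : δ < Real.pi / 2) {A : ℂ}
    (hA : 0 ≤ (exp (δ * I) * A).re) (hA' : 0 ≤ (exp ((-δ : ℝ) * I) * A).re) :
    Real.sin δ * ‖A‖ ≤ A.re := by
  have hs : 0 < Real.sin δ := Real.sin_pos_of_pos_of_lt_pi h0 (by linarith)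
  have hc : 0 < Real.cos δ := Real.cos_pos_of_mem_Ioo ⟨by linarith, h1⟩
  rw [mul_re, exp_ofReal_mul_I_re, exp_ofReal_mul_I_im] at hA hA'
  rw [Real.cos_neg, Real.sin_neg] at hA'
  have h2 : 0 ≤ A.re := by
    by_contra! h
    nlinarith [mul_neg_of_pos_of_neg hc h]
  refine abs_le_of_sq_le_sq' ?_ h2 |>.2
  rw [mul_pow, ← Complex.normSq_eq_norm_sq, Complex.normSq_apply]
  have h3 : (Real.sin δ * A.im) ^ 2 ≤ (Real.cos δ * A.re) ^ 2 :=
    sq_le_sq' (by linarith) (by linarith)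
  have h4 := Real.sin_sq_add_cos_sq δ
  have h5 : (Real.cos δ * A.re) ^ 2 = (1 - Real.sin δ ^ 2) * A.re ^ 2 := by
    rw [mul_pow]; congr 1; linarith
  rw [h5] at h3
  nlinarith

/-! ### Half-plane coordinates and location of the boundary point `σ`. -/

/-- The open right half-plane. -/
def rightHalfPlane : Set ℂ := {ζ : ℂ | 0 < ζ.re}

theorem isOpen_rightHalfPlane : IsOpen rightHalfPlane :=
  isOpen_lt continuous_const Complex.continuous_re

/-- The conformal map of the right half-plane onto the unit disk taking `∞` to `σ`. -/
noncomputable def toDisk (σ ζ : ℂ) : ℂ := σ * ((ζ - 1) / (ζ + 1))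

theorem add_one_ne_zero_of_re_nonneg {ζ : ℂ} (hζ : 0 ≤ ζ.re) : ζ + 1 ≠ 0 := by
  intro h
  have := congrArg Complex.re h
  simp at this
  linarith

theorem toDisk_mem {σ ζ : ℂ} (hσ : ‖σ‖ = 1) (hζ : ζ ∈ rightHalfPlane) :
    toDisk σ ζ ∈ unitDisk := by
  have hζ' : 0 < ζ.re := hζ
  have h1 := add_one_ne_zero_of_re_nonneg hζ'.le
  have h2 : ‖ζ - 1‖ < ‖ζ + 1‖ := by
    refine lt_of_pow_lt_pow_left₀ 2 (norm_nonneg _) ?_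
    rw [← Complex.normSq_eq_norm_sq, ← Complex.normSq_eq_norm_sq, Complex.normSq_apply,
      Complex.normSq_apply]
    simp
    nlinarith
  change ‖σ * ((ζ - 1) / (ζ + 1))‖ < 1
  rw [norm_mul, hσ, one_mul, norm_div, div_lt_one (norm_pos_iff.2 h1)]
  exact h2

theorem exists_toDisk_eq {σ z : ℂ} (hσ : ‖σ‖ = 1) (hz : z ∈ unitDisk) :
    ∃ ζ ∈ rightHalfPlane, toDisk σ ζ = z := by
  have hz' : ‖z‖ < 1 := hz
  have hne : σ ≠ z := by
    rintro rfl
    linarith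
  have hσ0 : σ ≠ 0 := by
    rintro rfl
    simp at hσ
  have h0 := sub_ne_zero.2 hne
  refine ⟨(σ + z) / (σ - z), ?_, ?_⟩
  · change 0 < ((σ + z) / (σ - z)).re
    rw [re_add_div_sub hσ hne]
    have : 0 < 1 - ‖z‖ ^ 2 := by nlinarith [norm_nonneg z]
    have := norm_pos_iff.2 h0
    positivity
  · have e1 : (σ + z) / (σ - z) - 1 = 2 * z / (σ - z) := by
      rw [eq_div_iff h0, sub_mul, div_mul_cancel₀ _ h0]; ring
    have e2 : (σ + z) / (σ - z) + 1 = 2 * σ / (σ - z) := by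
      rw [eq_div_iff h0, add_mul, div_mul_cancel₀ _ h0]; ring
    rw [toDisk, e1, e2, div_div_div_cancel_right₀ h0]
    field_simp

theorem sub_toDisk (σ : ℂ) {ζ : ℂ} (hζ : 0 ≤ ζ.re) : σ - toDisk σ ζ = 2 * σ / (ζ + 1) := by
  have h1 := add_one_ne_zero_of_re_nonneg hζ
  rw [toDisk, eq_div_iff h1, sub_mul, mul_assoc, div_mul_cancel₀ _ h1]
  ring

theorem hasDerivAt_toDisk (σ : ℂ) {ζ : ℂ} (hζ : 0 ≤ ζ.re) :
    HasDerivAt (toDisk σ) (2 * σ / (ζ + 1) ^ 2) ζ := by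
  have h1 := add_one_ne_zero_of_re_nonneg hζ
  have h2 := ((((hasDerivAt_id ζ).sub_const 1).fun_div ((hasDerivAt_id ζ).add_const 1) h1).const_mul
    σ)
  refine h2.congr_deriv ?_
  simp only [id]
  ring

theorem exists_re_mul_sub_eq {Φ Φ' : ℂ → ℂ}
    (hΦ : ∀ ζ ∈ rightHalfPlane, HasDerivAt Φ (Φ' ζ) ζ) {ζ d : ℂ} (hζ : ζ ∈ rightHalfPlane)
    (hd : ζ + d ∈ rightHalfPlane) :
    ∃ ξ ∈ rightHalfPlane, (Φ (ζ + d) - Φ ζ).re = (d * Φ' ξ).re := by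
  have hmem : ∀ s ∈ Icc (0 : ℝ) 1, ζ + s * d ∈ rightHalfPlane := by
    intro s hs
    have h1 : 0 < ζ.re := hζ
    have h2 : 0 < ζ.re + d.re := by simpa [rightHalfPlane] using hd
    have : 0 < ζ.re + s * d.re := by
      rcases hs.1.eq_or_lt with rfl | h
      · simpa using h1
      · nlinarith [hs.2]
    simpa [rightHalfPlane] using this
  have hder : ∀ s ∈ Icc (0 : ℝ) 1,
      HasDerivAt (fun s : ℝ => (Φ (ζ + s * d)).re) (d * Φ' (ζ + s * d)).re s := by
    intro s hs
    have h1 : HasDerivAt (fun s : ℝ => ζ + s * d) d s := by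
      simpa using ((Complex.ofRealCLM.hasDerivAt (x := s)).mul_const d).const_add ζ
    have h2 := HasDerivAt.comp (h := fun s : ℝ => ζ + s * d) (h₂ := Φ) s (hΦ _ (hmem s hs)) h1
    have h3 := Complex.reCLM.hasFDerivAt.comp_hasDerivAt s h2
    rw [mul_comm]
    exact h3
  obtain ⟨c, hc, hc'⟩ := exists_hasDerivAt_eq_slope (fun s : ℝ => (Φ (ζ + s * d)).re)
    (fun s => (d * Φ' (ζ + s * d)).re) zero_lt_one
    (fun s hs => (hder s hs).continuousAt.continuousWithinAt)
    (fun s hs => hder s (Ioo_subset_Icc_self hs))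
  refine ⟨_, hmem c (Ioo_subset_Icc_self hc), ?_⟩
  rw [hc']
  simp

/-- If the derivative of `Φ` has values in a closed sector of opening less than `π`, so do the
difference quotients of `Φ`. -/
theorem sin_mul_norm_le_re_sub {Φ Φ' : ℂ → ℂ}
    (hΦ : ∀ ζ ∈ rightHalfPlane, HasDerivAt Φ (Φ' ζ) ζ) {δ : ℝ} (h0 : 0 < δ) (h1 : δ < Real.pi / 2)
    (hA : ∀ ζ ∈ rightHalfPlane, 0 ≤ (exp (δ * I) * Φ' ζ).re)
    (hA' : ∀ ζ ∈ rightHalfPlane, 0 ≤ (exp ((-δ : ℝ) * I) * Φ' ζ).re)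
    {ζ d : ℂ} (hζ : ζ ∈ rightHalfPlane) (hd : ζ + d ∈ rightHalfPlane) :
    Real.sin δ * (‖d‖ * ‖Φ (ζ + d) - Φ ζ‖) ≤ ((starRingEnd ℂ) d * (Φ (ζ + d) - Φ ζ)).re := by
  have key : ∀ κ : ℂ, (∀ ζ ∈ rightHalfPlane, 0 ≤ (κ * Φ' ζ).re) →
      0 ≤ (κ * ((starRingEnd ℂ) d * (Φ (ζ + d) - Φ ζ))).re := by
    intro κ hκ
    -- The factor `conj d` combines with the increment `d` to the positive number `|d|²`.
    obtain ⟨ξ, hξ, he⟩ := exists_re_mul_sub_eq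
      (fun ζ hζ => (hΦ ζ hζ).const_mul (κ * (starRingEnd ℂ) d)) hζ hd
    rw [← mul_assoc, mul_sub, he,
      show d * (κ * (starRingEnd ℂ) d * Φ' ξ) = (Complex.normSq d : ℂ) * (κ * Φ' ξ) by
        rw [← Complex.mul_conj]; ring, Complex.re_ofReal_mul]
    exact mul_nonneg (Complex.normSq_nonneg d) (hκ ξ hξ)
  have := sin_mul_norm_le_re h0 h1 (key _ hA) (key _ hA')
  rwa [norm_mul, RCLike.norm_conj] at this

/-- Add the two inequalities. On the right the terms in `M * S` cancel, leaving at most `2‖S‖`; on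
the left `s * M = 2` produces `4‖S‖`. -/
theorem bounded_of_sin_mul_norm_le {s M : ℝ} (hs : 0 < s) (hM : s * M = 2) {S P Q : ℂ} {x : ℝ}
    (hx0 : 0 ≤ x) (hx1 : x ≤ 1)
    (h1 : s * (‖(x : ℂ) + M * I‖ * ‖P - S‖) ≤ ((starRingEnd ℂ) ((x : ℂ) + M * I) * (P - S)).re)
    (h2 : s * (‖(x : ℂ) - M * I‖ * ‖Q - S‖) ≤ ((starRingEnd ℂ) ((x : ℂ) - M * I) * (Q - S)).re) :
    ‖S‖ ≤ (3 + M) * (‖P‖ + ‖Q‖) / 2 := by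
  have hM0 : 0 < M := by
    by_contra! h
    nlinarith
  have hn1 : M ≤ ‖(x : ℂ) + M * I‖ := by
    simpa [abs_of_pos hM0] using Complex.abs_im_le_norm ((x : ℂ) + M * I)
  have hn2 : M ≤ ‖(x : ℂ) - M * I‖ := by
    simpa [abs_of_pos hM0] using Complex.abs_im_le_norm ((x : ℂ) - M * I)
  have hl1 : 2 * (‖S‖ - ‖P‖) ≤ s * (‖(x : ℂ) + M * I‖ * ‖P - S‖) := by
    have h3 : ‖S‖ - ‖P‖ ≤ ‖P - S‖ := by rw [norm_sub_rev]; exact norm_sub_norm_le _ _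
    have h4 := mul_le_mul_of_nonneg_left
      (mul_le_mul_of_nonneg_right hn1 (norm_nonneg (P - S))) hs.le
    rw [← mul_assoc, hM] at h4
    linarith
  have hl2 : 2 * (‖S‖ - ‖Q‖) ≤ s * (‖(x : ℂ) - M * I‖ * ‖Q - S‖) := by
    have h3 : ‖S‖ - ‖Q‖ ≤ ‖Q - S‖ := by rw [norm_sub_rev]; exact norm_sub_norm_le _ _
    have h4 := mul_le_mul_of_nonneg_left
      (mul_le_mul_of_nonneg_right hn2 (norm_nonneg (Q - S))) hs.le
    rw [← mul_assoc, hM] at h4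
    linarith
  have hP1 := Complex.re_le_norm P
  have hP2 := Complex.abs_im_le_norm P
  have hQ1 := Complex.re_le_norm Q
  have hQ2 := Complex.abs_im_le_norm Q
  have hS := neg_le_of_abs_le (Complex.abs_re_le_norm S)
  have hP3 := mul_le_mul_of_nonneg_left (le_of_abs_le hP2) hM0.le
  have hQ3 := mul_le_mul_of_nonneg_left (neg_le_of_abs_le hQ2) hM0.le
  simp at h1 h2
  have hx1P : x * P.re ≤ ‖P‖ := by
    rcases le_total 0 P.re with h | h <;> nlinarith [norm_nonneg P]
  have hx1Q : x * Q.re ≤ ‖Q‖ := by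
    rcases le_total 0 Q.re with h | h <;> nlinarith [norm_nonneg Q]
  have hxS : -(x * S.re) ≤ ‖S‖ := by
    rcases le_total 0 S.re with h | h <;> nlinarith [norm_nonneg S]
  nlinarith

/-- If the pull-back of `h` to the half-plane with `∞` at `σ` has its derivative in a sector of
opening less than `π`, then `h` is bounded along a path to each boundary point other than `σ`. -/
theorem eq_one_of_tendsto_cobounded {h : ℂ → ℂ} (hd : DifferentiableOn ℂ h unitDisk)
    (hinf : Tendsto h (𝓝[unitDisk] 1) (Bornology.cobounded ℂ)) {σ c : ℂ} (hσ : ‖σ‖ = 1)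
    (hc : c ≠ 0) {δ : ℝ} (h0 : 0 < δ) (h1 : δ < Real.pi / 2)
    (hA : ∀ ε : ℝ, (ε = δ ∨ ε = -δ) → ∀ z ∈ unitDisk,
      0 ≤ (exp (ε * I) * (c * (deriv h z * (σ - z) ^ 2 * (starRingEnd ℂ) σ))).re) : σ = 1 := by
  by_contra hne
  have hσσ : (starRingEnd ℂ) σ * σ = 1 := by
    rw [mul_comm, Complex.mul_conj, Complex.normSq_eq_norm_sq, hσ]; simp
  set H : ℂ → ℂ := fun ζ => c * h (toDisk σ ζ)
  set H' : ℂ → ℂ := fun ζ => c * (deriv h (toDisk σ ζ) * (2 * σ / (ζ + 1) ^ 2))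
  have hH : ∀ ζ ∈ rightHalfPlane, HasDerivAt H (H' ζ) ζ := by
    intro ζ hζ
    exact (((hd.differentiableAt (isOpen_unitDisk.mem_nhds (toDisk_mem hσ hζ))).hasDerivAt).comp ζ
      (hasDerivAt_toDisk σ (le_of_lt hζ))).const_mul c
  have hHA : ∀ ε : ℝ, (ε = δ ∨ ε = -δ) → ∀ ζ ∈ rightHalfPlane, 0 ≤ (exp (ε * I) * H' ζ).re := by
    intro ε hε ζ hζ
    have h2 := hA ε hε _ (toDisk_mem hσ hζ)
    rw [sub_toDisk σ (le_of_lt hζ)] at h2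
    have h3 := add_one_ne_zero_of_re_nonneg (le_of_lt hζ)
    have e : exp (ε * I) * (c * (deriv h (toDisk σ ζ) * (2 * σ / (ζ + 1)) ^ 2 * (starRingEnd ℂ) σ))
        = (2 : ℝ) * (exp (ε * I) * H' ζ) := by
      simp only [H', div_pow]
      push_cast
      linear_combination (exp (ε * I) * c * deriv h (toDisk σ ζ) * 4 * σ / (ζ + 1) ^ 2) * hσσ
    rw [e, Complex.re_ofReal_mul] at h2
    linarith
  -- The point of the imaginary axis that corresponds to `1`; the path `ζ₀ + x`, `x ↓ 0`, leads to
  -- `1` inside the disk.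
  set ζ₀ := (σ + 1) / (σ - 1) with hζ₀
  have hσ1 : σ - 1 ≠ 0 := sub_ne_zero.2 hne
  have hre : ζ₀.re = 0 := by rw [hζ₀, re_add_div_sub hσ hne]; simp
  have hT : toDisk σ ζ₀ = 1 := by
    have e1 : ζ₀ - 1 = 2 / (σ - 1) := by
      rw [hζ₀, eq_div_iff hσ1, sub_mul, div_mul_cancel₀ _ hσ1]; ring
    have e2 : ζ₀ + 1 = 2 * σ / (σ - 1) := by
      rw [hζ₀, eq_div_iff hσ1, add_mul, div_mul_cancel₀ _ hσ1]; ring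
    have : σ ≠ 0 := right_ne_zero_of_mul (hσσ ▸ one_ne_zero)
    rw [toDisk, e1, e2, div_div_div_cancel_right₀ hσ1]
    field_simp
  have hmem : ∀ x : ℝ, 0 < x → ζ₀ + x ∈ rightHalfPlane := by
    intro x hx
    simpa [rightHalfPlane, hre] using hx
  have hlim : Tendsto (fun x : ℝ => toDisk σ (ζ₀ + x)) (𝓝[>] 0) (𝓝[unitDisk] 1) := by
    refine tendsto_nhdsWithin_iff.2 ⟨?_, ?_⟩
    · have h2 : ContinuousAt (toDisk σ) (ζ₀ + (0 : ℝ)) := by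
        simpa using (hasDerivAt_toDisk σ hre.ge).continuousAt
      have h3 : ContinuousAt (fun x : ℝ => toDisk σ (ζ₀ + x)) 0 :=
        ContinuousAt.comp (f := fun x : ℝ => ζ₀ + x) h2 (by fun_prop)
      have h4 := h3.tendsto
      simp only [ofReal_zero, add_zero, hT] at h4
      exact h4.mono_left nhdsWithin_le_nhds
    · filter_upwards [self_mem_nhdsWithin] with x hx
      exact toDisk_mem hσ (hmem x hx)
  have hbig := tendsto_norm_cobounded_atTop.comp (hinf.comp hlim)
  have hs : 0 < Real.sin δ := Real.sin_pos_of_pos_of_lt_pi h0 (by linarith)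
  set M := 2 / Real.sin δ
  have hM : Real.sin δ * M = 2 := mul_div_cancel₀ _ hs.ne'
  -- Both points are independent of `x` and differ from `ζ₀ + x` by `(1 - x) ± M * I`, which makes
  -- the bound uniform along the path.
  set p := ζ₀ + 1 + M * I
  set q := ζ₀ + 1 - M * I
  have hp : p ∈ rightHalfPlane := by simp [rightHalfPlane, p, hre]
  have hq : q ∈ rightHalfPlane := by simp [rightHalfPlane, q, hre]
  have hbound : ∀ x ∈ Ioo (0 : ℝ) 1,
      ‖h (toDisk σ (ζ₀ + x))‖ ≤ (3 + M) * (‖H p‖ + ‖H q‖) / 2 / ‖c‖ := by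
    intro x hx
    have hζ := hmem x hx.1
    have ep : ζ₀ + x + (((1 - x : ℝ) : ℂ) + M * I) = p := by simp only [p]; push_cast; ring
    have eq : ζ₀ + x + (((1 - x : ℝ) : ℂ) - M * I) = q := by simp only [q]; push_cast; ring
    have i1 := sin_mul_norm_le_re_sub hH h0 h1 (hHA δ (Or.inl rfl)) (hHA (-δ) (Or.inr rfl)) hζ
      (ep ▸ hp)
    have i2 := sin_mul_norm_le_re_sub hH h0 h1 (hHA δ (Or.inl rfl)) (hHA (-δ) (Or.inr rfl)) hζ
      (eq ▸ hq)
    rw [ep] at i1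
    rw [eq] at i2
    have := bounded_of_sin_mul_norm_le hs hM (by linarith [hx.2] : 0 ≤ 1 - x) (by linarith [hx.1])
      i1 i2
    rw [le_div_iff₀ (norm_pos_iff.2 hc), mul_comm, ← norm_mul]
    exact this
  obtain ⟨x, hx1, hx2⟩ := ((hbig.eventually_gt_atTop ((3 + M) * (‖H p‖ + ‖H q‖) / 2 / ‖c‖)).and
    (Ioo_mem_nhdsGT (zero_lt_one' ℝ))).exists
  exact absurd (hbound x hx2) (not_le.2 hx1)

/-! ### The sector condition for concave functions. -/

/-- The derivative of a function in `CO(α)`, in half-plane coordinates, lies in a fixed sector of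
opening `π (α - 1)`. -/
theorem IsConcaveUnivalent.exists_rotation {α : ℝ} (hα : α ∈ Ioo (1 : ℝ) 2) {h : ℂ → ℂ}
    (hh : IsConcaveUnivalent α h) :
    ∃ c : ℂ, ‖c‖ = 1 ∧ ∀ z ∈ unitDisk, deriv h z ≠ 0 ∧
      Real.sin ((2 - α) / 2 * Real.pi) * ‖c * (deriv h z * (1 - z) ^ 2)‖ ≤
        (c * (deriv h z * (1 - z) ^ 2)).re := by
  have hd := hh.analytic
  obtain ⟨hopen, hder, g, hg, hgd⟩ := exists_holomorphic_inverse isOpen_unitDisk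
    convex_unitDisk.isPreconnected
    ⟨0, by simp [unitDisk], 1 / 2, by simp [unitDisk]; norm_num, by norm_num⟩ hd hh.univalent
  set Ω := h '' unitDisk with hΩ
  have h0Ω : (0 : ℂ) ∈ Ω := ⟨0, by simp [unitDisk], hh.map_zero⟩
  set δ := (2 - α) / 2 * Real.pi with hδdef
  have hπ := Real.pi_pos
  have hδ0 : 0 < δ := by have := hα.2; positivity
  have hδ1 : δ < Real.pi / 2 := by have := hα.1; rw [hδdef]; nlinarith
  have hvol := le_volume_recession_directions hopen hh.convex_compl (by linarith [hα.1])
    hh.opening_le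
  rw [show 2 * Real.pi - Real.pi * α = 2 * δ by rw [hδdef]; ring] at hvol
  -- Otherwise the inverse of `h` would be a bounded entire function, hence constant by Liouville.
  have hne : Ωᶜ.Nonempty := by
    by_contra hemp
    rw [not_nonempty_iff_eq_empty, compl_empty_iff] at hemp
    have hgdiff : Differentiable ℂ g := by rwa [hemp, differentiableOn_univ] at hgd
    have hbdd : Bornology.IsBounded (range g) := by
      refine (Metric.isBounded_ball (x := (0 : ℂ)) (r := 1)).subset ?_
      rintro _ ⟨y, rfl⟩
      obtain ⟨x, hx, rfl⟩ : y ∈ Ω := hemp ▸ mem_univ y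
      rw [hg x hx, ← unitDisk_eq_ball]
      exact hx
    have h3 := hgdiff.apply_eq_apply_of_bounded hbdd (h 0) (h (1 / 2))
    rw [hg 0 (by simp [unitDisk]), hg (1 / 2) (by simp [unitDisk]; norm_num)] at h3
    norm_num at h3
  obtain ⟨v, hv, hpos⟩ := exists_unit_vector_re_pos hopen.isClosed_compl hh.convex_compl hne
    (fun h' => h' h0Ω)
  have hvexp : exp ((arg v : ℝ) * I) = v := by
    have := Complex.norm_mul_exp_arg_mul_I v
    rwa [hv, ofReal_one, one_mul] at this
  obtain ⟨γ, hγ1, hγ2⟩ := exists_sector_subset_recessionCone hopen (γ₀ := arg v)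
    hδ0 (by rwa [hvexp]) hne hvol
  -- `Ω` contains the half-plane `Re (conj v * w) ≤ 0`, and these disks lie in it, tangent to its
  -- boundary at `0`.
  have hball : ∀ n : ℕ, Metric.ball (-((n + 1 : ℝ) * v)) (n + 1) ⊆ Ω := by
    intro n w hw
    by_contra hwΩ
    have h3 := hpos w hwΩ
    rw [mem_ball_iff_norm] at hw
    have h4 := Complex.re_le_norm ((starRingEnd ℂ) v * (w - -((n + 1 : ℝ) * v)))
    rw [norm_mul, RCLike.norm_conj, hv, one_mul] at h4
    have h5 : (starRingEnd ℂ) v * v = 1 := by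
      rw [mul_comm, Complex.mul_conj, Complex.normSq_eq_norm_sq, hv]; simp
    have h6 : (starRingEnd ℂ) v * (w - -((n + 1 : ℝ) * v)) =
        (starRingEnd ℂ) v * w + (n + 1 : ℝ) := by
      linear_combination ((n + 1 : ℝ) : ℂ) * h5
    rw [h6, add_re, ofReal_re] at h4
    push_cast at hw h4
    linarith
  have hnorm : ∀ n : ℕ, ‖-((n + 1 : ℝ) * v)‖ = (n + 1 : ℝ) := by
    intro n
    rw [norm_neg, norm_mul, hv, mul_one, Complex.norm_real, Real.norm_of_nonneg (by positivity)]
  have hrlim : Tendsto (fun n : ℕ => (n + 1 : ℝ)) atTop atTop :=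
    tendsto_atTop_add_const_right _ _ tendsto_natCast_atTop_atTop
  obtain ⟨σ, hσ, φ, hφ, hlim⟩ := exists_subseq_tendsto_circle hd hg
    (w := fun n : ℕ => -((n + 1 : ℝ) * v))
    (fun n => hball n (Metric.mem_ball_self (by positivity))) (by simpa only [hnorm] using hrlim)
  have hcone : ∀ u ∈ recessionCone Ωᶜ, ∀ z ∈ unitDisk,
      0 ≤ ((starRingEnd ℂ) u * -(deriv h z * (σ - z) ^ 2 * (starRingEnd ℂ) σ)).re := by
    intro u hu z hz
    refine re_conj_mul_deriv_nonneg hd hopen hder hg hgd (fun n => hball (φ n))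
      (fun n => by positivity) (hrlim.comp hφ.tendsto_atTop) hσ hlim ?_ hz
    intro x hx t ht
    by_contra hcon
    have := hu _ hcon t ht
    rw [sub_add_cancel] at this
    exact this ⟨x, hx, rfl⟩
  -- Chosen so that `-conj (exp ((γ - ε) * I)) = exp (ε * I) * c`: the two extreme recession
  -- directions become rotations by `±δ`.
  set c : ℂ := -exp ((-γ : ℝ) * I) with hc
  have hc1 : ‖c‖ = 1 := by rw [hc, norm_neg, Complex.norm_exp_ofReal_mul_I]
  have hA : ∀ ε : ℝ, (ε = δ ∨ ε = -δ) → ∀ z ∈ unitDisk,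
      0 ≤ (exp (ε * I) * (c * (deriv h z * (σ - z) ^ 2 * (starRingEnd ℂ) σ))).re := by
    intro ε hε z hz
    have hmem : exp ((γ - ε : ℝ) * I) ∈ recessionCone Ωᶜ := by
      rcases hε with rfl | rfl
      · exact hγ2
      · rwa [sub_neg_eq_add]
    have h3 := hcone _ hmem z hz
    have e : (starRingEnd ℂ) (exp ((γ - ε : ℝ) * I)) = exp (ε * I) * exp ((-γ : ℝ) * I) := by
      rw [← Complex.exp_conj, ← Complex.exp_add]
      congr 1
      simp
      ring
    rw [e] at h3
    convert h3 using 2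
    rw [hc]
    ring
  have hσ1 : σ = 1 := eq_one_of_tendsto_cobounded hd hh.map_one hσ
    (norm_ne_zero_iff.1 (hc1 ▸ one_ne_zero)) hδ0 hδ1 hA
  have hA1 : ∀ ε : ℝ, (ε = δ ∨ ε = -δ) → ∀ z ∈ unitDisk,
      0 ≤ (exp (ε * I) * (c * (deriv h z * (1 - z) ^ 2))).re := by
    intro ε hε z hz
    simpa only [hσ1, _root_.map_one, mul_one] using hA ε hε z hz
  exact ⟨c, hc1, fun z hz => ⟨hder z hz,
    sin_mul_norm_le_re hδ0 hδ1 (hA1 δ (Or.inl rfl) z hz) (hA1 (-δ) (Or.inr rfl) z hz)⟩⟩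

/-! ### A minimum principle in a half-strip. -/

theorem half_add_one_le_cosh (x : ℝ) : (x + 1) / 2 ≤ Real.cosh x := by
  rw [Real.cosh_eq]
  have h1 := Real.add_one_le_exp x
  have h2 := Real.exp_pos (-x)
  linarith

/-- A minimum principle in a vertical half-strip for harmonic functions which increase upwards. -/
theorem exists_im_gt_of_mem_Ioo {Φ : ℂ → ℂ} (hΦ : DifferentiableOn ℂ Φ rightHalfPlane)
    (hmono : ∀ c : ℝ, 0 < c → StrictMono fun v : ℝ => (Φ (c + v * I)).im)
    {c₁ c₂ c y : ℝ} (hc₁ : 0 < c₁) (hc : c ∈ Ioo c₁ c₂)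
    (h₁ : ∃ v : ℝ, y < (Φ (c₁ + v * I)).im) (h₂ : ∃ v : ℝ, y < (Φ (c₂ + v * I)).im) :
    ∃ v : ℝ, y < (Φ (c + v * I)).im := by
  obtain ⟨v₁, hv₁⟩ := h₁
  obtain ⟨v₂, hv₂⟩ := h₂
  have hc12 : c₁ < c₂ := hc.1.trans hc.2
  set V := max v₁ v₂
  set y' := min (Φ (c₁ + V * I)).im (Φ (c₂ + V * I)).im with hy'
  have hyy' : y < y' := lt_min
    (hv₁.trans_le ((hmono c₁ hc₁).monotone (le_max_left _ _)))
    (hv₂.trans_le ((hmono c₂ (hc₁.trans hc12)).monotone (le_max_right _ _)))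
  have hmem : ∀ x v : ℝ, 0 < x → (x + v * I : ℂ) ∈ rightHalfPlane := by
    intro x v hx
    simpa [rightHalfPlane] using hx
  have hcont : ContinuousOn (fun x : ℝ => (Φ (x + V * I)).im) (Icc c₁ c₂) := by
    refine Complex.continuous_im.comp_continuousOn (hΦ.continuousOn.comp (by fun_prop) ?_)
    exact fun x hx => hmem x V (hc₁.trans_le hx.1)
  obtain ⟨x₀, -, hx₀⟩ := isCompact_Icc.exists_isMinOn (nonempty_Icc.2 hc12.le) hcont
  set m := (Φ (x₀ + V * I)).im with hm
  have hbot : ∀ x ∈ Icc c₁ c₂, ∀ v, V ≤ v → m ≤ (Φ (x + v * I)).im := by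
    intro x hx v hv
    exact (hx₀ hx : m ≤ _).trans ((hmono x (hc₁.trans_le hx.1)).monotone hv)
  have hcos1 : 0 < Real.cos 1 := Real.cos_one_pos
  -- The barrier `b * Re (cos (u ζ))` is nonnegative on a rectangle of width `2w` and height `2L`.
  -- On the horizontal edges, where only `Im Φ ≥ m` is known, it is at least `B * cos 1 ≥ y' - m`.
  set B := (|y' - m| + 1) / Real.cos 1 with hB
  have hB0 : 0 < B := by positivity
  have hBc : y' - m ≤ B * Real.cos 1 := by
    rw [hB, div_mul_cancel₀ _ hcos1.ne']
    linarith [le_abs_self (y' - m)]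
  set w := (c₂ - c₁) / 2 with hw
  have hw0 : 0 < w := by rw [hw]; linarith
  set cm := (c₁ + c₂) / 2 with hcm
  -- A rectangle this tall makes the barrier at mid-height, where `cosh` is `1`, at most `b = B /
  -- cosh T < y' - y`.
  set T := 2 * B / (y' - y) with hT
  have hT0 : 0 < T := div_pos (by linarith) (by linarith)
  set L := w * T with hL
  have hL0 : 0 < L := mul_pos hw0 hT0
  set b := B / Real.cosh T with hb
  have hb0 : 0 < b := div_pos hB0 (Real.cosh_pos T)
  have hby : b < y' - y := by
    rw [hb, div_lt_iff₀ (Real.cosh_pos T)]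
    have h1 := half_add_one_le_cosh T
    have h2 : T * (y' - y) = 2 * B := div_mul_cancel₀ _ (by linarith)
    nlinarith
  set u : ℂ → ℂ := fun ζ => (ζ - (cm + (V + L : ℝ) * I)) / w with hu
  -- `‖E‖ = exp (-(Im Φ - y' + barrier))`, so the maximum modulus principle for `E` is the minimum
  -- principle wanted.
  set E : ℂ → ℂ := fun ζ => exp (I * (Φ ζ - I * y' + I * (b * cos (u ζ)))) with hE
  have hucos : ∀ x v : ℝ, (cos (u (x + v * I))).re =
      Real.cos ((x - cm) / w) * Real.cosh ((v - (V + L)) / w) := by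
    intro x v
    have : u (x + v * I) = (((x - cm) / w : ℝ) : ℂ) + (((v - (V + L)) / w : ℝ) : ℂ) * I := by
      simp only [hu]
      push_cast
      ring
    rw [this, Complex.cos_add_mul_I, ← ofReal_cos, ← ofReal_cosh, ← ofReal_sin, ← ofReal_sinh]
    simp only [sub_re, mul_re, ofReal_re, ofReal_im, I_re, I_im, mul_im]
    ring
  have hEn : ∀ x v : ℝ, ‖E (x + v * I)‖ = Real.exp (-((Φ (x + v * I)).im - y' +
      b * (Real.cos ((x - cm) / w) * Real.cosh ((v - (V + L)) / w)))) := by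
    intro x v
    rw [Complex.norm_exp, ← hucos]
    congr 1
    simp
  have hsub : closure (Ioo c₁ c₂ ×ℂ Ioo V (V + 2 * L)) ⊆ Icc c₁ c₂ ×ℂ Icc V (V + 2 * L) :=
    closure_minimal (fun ζ hζ => ⟨Ioo_subset_Icc_self hζ.1, Ioo_subset_Icc_self hζ.2⟩)
      (isClosed_Icc.reProdIm isClosed_Icc)
  have hEd : DiffContOnCl ℂ E (Ioo c₁ c₂ ×ℂ Ioo V (V + 2 * L)) := by
    refine DifferentiableOn.diffContOnCl fun ζ hζ => ?_
    have hζP : ζ ∈ rightHalfPlane := hc₁.trans_le (hsub hζ).1.1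
    have h1 := hΦ.differentiableAt (isOpen_rightHalfPlane.mem_nhds hζP)
    have h2 : DifferentiableAt ℂ u ζ := by fun_prop
    exact (((h1.sub_const _).add ((h2.ccos.const_mul _).const_mul _)).const_mul _).cexp
      |>.differentiableWithinAt
  have hbound := Complex.norm_le_of_forall_mem_frontier_norm_le
    (Bornology.IsBounded.reProdIm (Metric.isBounded_Ioo c₁ c₂) (Metric.isBounded_Ioo V (V + 2 * L)))
    hEd (C := 1) ?_ (z := c + (V + L : ℝ) * I) (subset_closure ?_)
  · rw [hEn, Real.exp_le_one_iff, sub_self, zero_div, Real.cosh_zero, mul_one] at hbound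
    refine ⟨V + L, ?_⟩
    have := Real.cos_le_one ((c - cm) / w)
    nlinarith
  · intro ζ hζ
    rw [frontier, ((isOpen_Ioo).reProdIm isOpen_Ioo).interior_eq] at hζ
    obtain ⟨hζc, hζn⟩ := hζ
    obtain ⟨hre, him⟩ := hsub hζc
    simp only [mem_preimage] at hre him
    rw [show ζ = ζ.re + ζ.im * I from (Complex.re_add_im ζ).symm, hEn, Real.exp_le_one_iff, neg_nonpos]
    have hangle : Real.cos 1 ≤ Real.cos ((ζ.re - cm) / w) := by
      have h3 : |(ζ.re - cm) / w| ≤ 1 := by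
        rw [abs_div, abs_of_pos hw0, div_le_one hw0, abs_le]
        constructor <;> linarith [hre.1, hre.2]
      rw [← Real.cos_abs ((ζ.re - cm) / w)]
      exact Real.cos_le_cos_of_nonneg_of_le_pi (abs_nonneg _) (by linarith [Real.pi_gt_three]) h3
    have hcosh := Real.cosh_pos ((ζ.im - (V + L)) / w)
    have hnn : 0 ≤ b * (Real.cos ((ζ.re - cm) / w) * Real.cosh ((ζ.im - (V + L)) / w)) := by
      have := hcos1.le.trans hangle
      positivity
    have hside : y' ≤ (Φ (ζ.re + ζ.im * I)).im → 0 ≤ (Φ (ζ.re + ζ.im * I)).im - y' +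
      b * (Real.cos ((ζ.re - cm) / w) * Real.cosh ((ζ.im - (V + L)) / w)) := fun h => by linarith
    have hend : Real.cosh ((ζ.im - (V + L)) / w) = Real.cosh T → 0 ≤ (Φ (ζ.re + ζ.im * I)).im - y' +
      b * (Real.cos ((ζ.re - cm) / w) * Real.cosh ((ζ.im - (V + L)) / w)) := by
      intro h
      have h4 : b * Real.cosh T = B := div_mul_cancel₀ _ (Real.cosh_pos T).ne'
      have h5 := hbot ζ.re hre ζ.im him.1
      rw [h, mul_left_comm, h4]
      nlinarith
    rcases hre.1.eq_or_lt with h | h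
    · refine hside ?_
      rw [← h]
      exact (min_le_left _ _).trans ((hmono c₁ hc₁).monotone him.1)
    rcases hre.2.eq_or_lt with h' | h'
    · refine hside ?_
      rw [h']
      exact (min_le_right _ _).trans ((hmono c₂ (hc₁.trans hc12)).monotone him.1)
    rcases him.1.eq_or_lt with h3 | h3
    · refine hend ?_
      rw [← h3, ← Real.cosh_neg]
      congr 1
      rw [hL]; field_simp; ring
    rcases him.2.eq_or_lt with h4 | h4
    · refine hend ?_
      rw [h4]
      congr 1
      rw [hL]; field_simp; ring
    exact absurd ⟨⟨h, h'⟩, ⟨h3, h4⟩⟩ hζn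
  · constructor
    · simpa using hc
    · have : L < 2 * L := by linarith
      simpa using ⟨hL0, this⟩

/-! ### Criteria for close-to-convexity. -/

theorem IsCloseToConvexDomain.image_mul {Ω : Set ℂ} (hΩ : IsCloseToConvexDomain Ω) {c : ℂ}
    (hc : c ≠ 0) : IsCloseToConvexDomain ((c * ·) '' Ω) := by
  obtain ⟨S, hS, hdisj, hU⟩ := hΩ
  have ho : ∀ a u : ℂ, openHalfLine (c * a) (c * u) = (c * ·) '' openHalfLine a u := by
    intro a u
    ext w
    constructor
    · rintro ⟨t, ht, rfl⟩
      exact ⟨_, ⟨t, ht, rfl⟩, by ring⟩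
    · rintro ⟨_, ⟨t, ht, rfl⟩, rfl⟩
      exact ⟨t, ht, by ring⟩
  have hcl : ∀ a u : ℂ, closedHalfLine (c * a) (c * u) = (c * ·) '' closedHalfLine a u := by
    intro a u
    ext w
    constructor
    · rintro ⟨t, ht, rfl⟩
      exact ⟨_, ⟨t, ht, rfl⟩, by ring⟩
    · rintro ⟨_, ⟨t, ht, rfl⟩, rfl⟩
      exact ⟨t, ht, by ring⟩
  refine ⟨(fun p : ℂ × ℂ => (c * p.1, c * p.2)) '' S, ?_, ?_, ?_⟩
  · rintro _ ⟨p, hp, rfl⟩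
    exact mul_ne_zero hc (hS p hp)
  · rintro _ ⟨p, hp, rfl⟩ _ ⟨q, hq, rfl⟩ hpq
    have hne : p ≠ q := fun h => hpq (by rw [h])
    simp only [Function.onFun, ho]
    exact (disjoint_image_iff (mul_right_injective₀ hc)).2 (hdisj hp hq hne)
  · have hbij : Function.Bijective (c * ·) := (Equiv.mulLeft₀ c hc).bijective
    rw [← image_compl_eq hbij, hU, image_iUnion₂, biUnion_image]
    simp only [hcl]

/-- The complement of a nonempty slice consists of at most two half-lines, from its supremum to the
right and from its infimum to the left. The endpoints are missed by `Ω` because slices have no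
extremal elements. -/
theorem isCloseToConvexDomain_of_slices {Ω : Set ℂ}
    (hord : ∀ y : ℝ, OrdConnected {x : ℝ | (x + y * I : ℂ) ∈ Ω})
    (hmax : ∀ x y : ℝ, (x + y * I : ℂ) ∈ Ω → ∃ x', x < x' ∧ (x' + y * I : ℂ) ∈ Ω)
    (hmin : ∀ x y : ℝ, (x + y * I : ℂ) ∈ Ω → ∃ x', x' < x ∧ (x' + y * I : ℂ) ∈ Ω) :
    IsCloseToConvexDomain Ω := by
  set s : ℝ → Set ℝ := fun y => {x : ℝ | (x + y * I : ℂ) ∈ Ω} with hs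
  have hsΩ : ∀ w : ℂ, w.re ∈ s w.im ↔ w ∈ Ω := fun w => by simp [hs, Complex.re_add_im]
  -- A line missing `Ω` is cut at real part `0` into two half-lines, which share only their end
  -- point.
  set R : Set (ℂ × ℂ) := {p | p.2 = 1 ∧
    ((s p.1.im).Nonempty ∧ IsLUB (s p.1.im) p.1.re ∨ s p.1.im = ∅ ∧ p.1.re = 0)} with hR
  set L : Set (ℂ × ℂ) := {p | p.2 = -1 ∧
    ((s p.1.im).Nonempty ∧ IsGLB (s p.1.im) p.1.re ∨ s p.1.im = ∅ ∧ p.1.re = 0)} with hL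
  have hRe : ∀ p ∈ R, ∀ w, w ∈ closedHalfLine p.1 p.2 ↔ w.im = p.1.im ∧ p.1.re ≤ w.re := by
    rintro ⟨a, u⟩ ⟨rfl : u = 1, -⟩ w
    constructor
    · rintro ⟨t, ht, rfl⟩
      simpa using ht
    · rintro ⟨h1, h2⟩
      exact ⟨w.re - a.re, sub_nonneg.2 h2, Complex.ext (by simp) (by simp [h1])⟩
  have hLe : ∀ p ∈ L, ∀ w, w ∈ closedHalfLine p.1 p.2 ↔ w.im = p.1.im ∧ w.re ≤ p.1.re := by
    rintro ⟨a, u⟩ ⟨rfl : u = -1, -⟩ w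
    constructor
    · rintro ⟨t, ht, rfl⟩
      simpa using ht
    · rintro ⟨h1, h2⟩
      exact ⟨a.re - w.re, sub_nonneg.2 h2, Complex.ext (by simp) (by simp [h1])⟩
  have hRo : ∀ p ∈ R, ∀ w ∈ openHalfLine p.1 p.2, w.im = p.1.im ∧ p.1.re < w.re := by
    rintro ⟨a, u⟩ ⟨rfl : u = 1, -⟩ _ ⟨t, ht, rfl⟩
    simpa using ht
  have hLo : ∀ p ∈ L, ∀ w ∈ openHalfLine p.1 p.2, w.im = p.1.im ∧ w.re < p.1.re := by
    rintro ⟨a, u⟩ ⟨rfl : u = -1, -⟩ _ ⟨t, ht, rfl⟩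
    simpa using ht
  have hRL : ∀ p ∈ R, ∀ q ∈ L, Disjoint (openHalfLine p.1 p.2) (openHalfLine q.1 q.2) := by
    intro p hp q hq
    rw [Set.disjoint_left]
    intro w hw hw'
    obtain ⟨h1, h2⟩ := hRo p hp w hw
    obtain ⟨h3, h4⟩ := hLo q hq w hw'
    have hp' := hp.2
    have hq' := hq.2
    rw [← h1] at hp'
    rw [← h3] at hq'
    rcases hp' with ⟨⟨x, hx⟩, hp'⟩ | ⟨he, hp'⟩
    · rcases hq' with ⟨-, hq'⟩ | ⟨he, -⟩
      · linarith [hp'.1 hx, hq'.1 hx]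
      · rw [he] at hx
        exact hx
    · rcases hq' with ⟨⟨x, hx⟩, hq'⟩ | ⟨-, hq'⟩
      · rw [he] at hx
        exact hx
      · linarith
  refine ⟨R ∪ L, ?_, ?_, ?_⟩
  · rintro p (hp | hp)
    · rw [hp.1]
      exact one_ne_zero
    · rw [hp.1]
      exact neg_ne_zero.2 one_ne_zero
  · rintro p (hp | hp) q (hq | hq) hpq
    · refine Set.disjoint_left.2 fun w hw hw' => hpq ?_
      have h1 := (hRo p hp w hw).1
      have h3 := (hRo q hq w hw').1
      refine Prod.ext (Complex.ext ?_ (h1.symm.trans h3)) (hp.1.trans hq.1.symm)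
      have hp' := hp.2
      have hq' := hq.2
      rw [← h1] at hp'
      rw [← h3] at hq'
      rcases hp' with ⟨hn, hp'⟩ | ⟨he, hp'⟩ <;> rcases hq' with ⟨hn', hq'⟩ | ⟨he', hq'⟩
      · exact hp'.unique hq'
      · exact absurd he' hn.ne_empty
      · exact absurd he hn'.ne_empty
      · rw [hp', hq']
    · exact hRL p hp q hq
    · exact (hRL q hq p hp).symm
    · refine Set.disjoint_left.2 fun w hw hw' => hpq ?_
      have h1 := (hLo p hp w hw).1
      have h3 := (hLo q hq w hw').1
      refine Prod.ext (Complex.ext ?_ (h1.symm.trans h3)) (hp.1.trans hq.1.symm)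
      have hp' := hp.2
      have hq' := hq.2
      rw [← h1] at hp'
      rw [← h3] at hq'
      rcases hp' with ⟨hn, hp'⟩ | ⟨he, hp'⟩ <;> rcases hq' with ⟨hn', hq'⟩ | ⟨he', hq'⟩
      · exact hp'.unique hq'
      · exact absurd he' hn.ne_empty
      · exact absurd he hn'.ne_empty
      · rw [hp', hq']
  · ext w
    rw [mem_compl_iff, mem_iUnion₂]
    constructor
    · intro hw
      rcases (s w.im).eq_empty_or_nonempty with he | ⟨x, hx⟩
      · rcases le_total 0 w.re with h | h
        · have hp : ((⟨0, w.im⟩, 1) : ℂ × ℂ) ∈ R := ⟨rfl, Or.inr ⟨he, rfl⟩⟩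
          exact ⟨_, Or.inl hp, (hRe _ hp w).2 ⟨rfl, h⟩⟩
        · have hp : ((⟨0, w.im⟩, -1) : ℂ × ℂ) ∈ L := ⟨rfl, Or.inr ⟨he, rfl⟩⟩
          exact ⟨_, Or.inr hp, (hLe _ hp w).2 ⟨rfl, h⟩⟩
      · have hws : w.re ∉ s w.im := fun h => hw ((hsΩ w).1 h)
        have hne : x ≠ w.re := fun h => hws (h ▸ hx)
        rcases lt_or_gt_of_ne hne with h | h
        · have hub : w.re ∈ upperBounds (s w.im) := fun x' hx' =>
            not_lt.1 fun hlt => hws ((hord w.im).out hx hx' ⟨h.le, hlt.le⟩)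
          have hp : ((⟨sSup (s w.im), w.im⟩, 1) : ℂ × ℂ) ∈ R :=
            ⟨rfl, Or.inl ⟨⟨x, hx⟩, isLUB_csSup ⟨x, hx⟩ ⟨_, hub⟩⟩⟩
          exact ⟨_, Or.inl hp, (hRe _ hp w).2 ⟨rfl, csSup_le ⟨x, hx⟩ hub⟩⟩
        · have hlb : w.re ∈ lowerBounds (s w.im) := fun x' hx' =>
            not_lt.1 fun hlt => hws ((hord w.im).out hx' hx ⟨hlt.le, h.le⟩)
          have hp : ((⟨sInf (s w.im), w.im⟩, -1) : ℂ × ℂ) ∈ L :=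
            ⟨rfl, Or.inl ⟨⟨x, hx⟩, isGLB_csInf ⟨x, hx⟩ ⟨_, hlb⟩⟩⟩
          exact ⟨_, Or.inr hp, (hLe _ hp w).2 ⟨rfl, le_csInf ⟨x, hx⟩ hlb⟩⟩
    · rintro ⟨p, hp | hp, hw⟩ hwΩ
      · obtain ⟨h1, h2⟩ := (hRe p hp w).1 hw
        have hws := (hsΩ w).2 hwΩ
        have hp' := hp.2
        rw [← h1] at hp'
        rcases hp' with ⟨-, hp'⟩ | ⟨he, -⟩
        · obtain ⟨x', hx', hx's⟩ := hmax w.re w.im hws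
          linarith [hp'.1 (hx's : x' ∈ s w.im)]
        · rw [he] at hws
          exact hws
      · obtain ⟨h1, h2⟩ := (hLe p hp w).1 hw
        have hws := (hsΩ w).2 hwΩ
        have hp' := hp.2
        rw [← h1] at hp'
        rcases hp' with ⟨-, hp'⟩ | ⟨he, -⟩
        · obtain ⟨x', hx', hx's⟩ := hmin w.re w.im hws
          linarith [hp'.1 (hx's : x' ∈ s w.im)]
        · rw [he] at hws
          exact hws

/-! ### Strictly accretive harmonic maps of the half-plane. -/

/-- A harmonic map of the half-plane whose real derivative is strictly accretive is strictly
monotone. -/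
theorem re_conj_mul_sub_pos {H G H' G' F : ℂ → ℂ}
    (hH : ∀ ζ ∈ rightHalfPlane, HasDerivAt H (H' ζ) ζ)
    (hG : ∀ ζ ∈ rightHalfPlane, HasDerivAt G (G' ζ) ζ)
    (hHG : ∀ ζ ∈ rightHalfPlane, ‖G' ζ‖ < (H' ζ).re)
    (hF : ∀ ζ ∈ rightHalfPlane, F ζ = H ζ + (starRingEnd ℂ) (G ζ))
    {ζ₁ ζ₂ : ℂ} (h₁ : ζ₁ ∈ rightHalfPlane) (h₂ : ζ₂ ∈ rightHalfPlane) (hne : ζ₁ ≠ ζ₂) :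
    0 < ((starRingEnd ℂ) (ζ₂ - ζ₁) * (F ζ₂ - F ζ₁)).re := by
  set d := ζ₂ - ζ₁ with hd
  have hd0 : d ≠ 0 := sub_ne_zero.2 hne.symm
  have e : ζ₁ + d = ζ₂ := by rw [hd]; ring
  -- `conj d * conj G` and `d * G` have the same real part, so `conj d * F` may be replaced by the
  -- holomorphic `conj d * H + d * G`.
  obtain ⟨ξ, hξ, he⟩ := exists_re_mul_sub_eq
    (fun ζ hζ => ((hH ζ hζ).const_mul ((starRingEnd ℂ) d)).add ((hG ζ hζ).const_mul d)) h₁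
    (e ▸ h₂ : ζ₁ + d ∈ rightHalfPlane)
  rw [e] at he
  have h3 : ((starRingEnd ℂ) d * (F ζ₂ - F ζ₁)).re =
      (((starRingEnd ℂ) d * H ζ₂ + d * G ζ₂) - ((starRingEnd ℂ) d * H ζ₁ + d * G ζ₁)).re := by
    rw [hF _ h₁, hF _ h₂]
    simp
    ring
  rw [h3]
  refine lt_of_lt_of_eq ?_ he.symm
  have h4 : d * ((starRingEnd ℂ) d * H' ξ + d * G' ξ) = (Complex.normSq d : ℂ) * H' ξ +
      d ^ 2 * G' ξ := by
    rw [← Complex.mul_conj]; ring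
  rw [h4, add_re, Complex.re_ofReal_mul]
  have h5 := neg_le_of_abs_le (Complex.abs_re_le_norm (d ^ 2 * G' ξ))
  rw [norm_mul, norm_pow, ← Complex.normSq_eq_norm_sq] at h5
  have h6 : 0 < Complex.normSq d := Complex.normSq_pos.2 hd0
  nlinarith [mul_lt_mul_of_pos_left (hHG ξ hξ) h6]

/-- The image of a strictly accretive harmonic map of the half-plane meets the horizontal lines in
open intervals, hence is close-to-convex. -/
theorem isCloseToConvexDomain_image_rightHalfPlane {H G H' G' F : ℂ → ℂ}
    (hH : ∀ ζ ∈ rightHalfPlane, HasDerivAt H (H' ζ) ζ)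
    (hG : ∀ ζ ∈ rightHalfPlane, HasDerivAt G (G' ζ) ζ)
    (hHG : ∀ ζ ∈ rightHalfPlane, ‖G' ζ‖ < (H' ζ).re)
    (hF : ∀ ζ ∈ rightHalfPlane, F ζ = H ζ + (starRingEnd ℂ) (G ζ)) :
    IsCloseToConvexDomain (F '' rightHalfPlane) := by
  have hpos := fun {ζ₁ ζ₂ : ℂ} => re_conj_mul_sub_pos (ζ₁ := ζ₁) (ζ₂ := ζ₂) hH hG hHG hF
  have hmem : ∀ x v : ℝ, 0 < x → (x + v * I : ℂ) ∈ rightHalfPlane := by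
    intro x v hx
    simpa [rightHalfPlane] using hx
  have hFc : ContinuousOn F rightHalfPlane := by
    refine ContinuousOn.congr (f := fun ζ => H ζ + (starRingEnd ℂ) (G ζ)) ?_ hF
    exact ContinuousOn.add (fun ζ hζ => (hH ζ hζ).continuousAt.continuousWithinAt)
      (Complex.continuous_conj.comp_continuousOn
        (fun ζ hζ => (hG ζ hζ).continuousAt.continuousWithinAt))
  have hFat : ∀ ζ ∈ rightHalfPlane, ContinuousAt F ζ := fun ζ hζ =>
    hFc.continuousAt (isOpen_rightHalfPlane.mem_nhds hζ)
  have hmono : ∀ c : ℝ, 0 < c → StrictMono fun v : ℝ => (F (c + v * I)).im := by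
    intro c hc v v' hv
    have hne : (c + v * I : ℂ) ≠ c + v' * I := by
      intro h
      have := congrArg Complex.im h
      simp at this
      exact hv.ne this
    have h1 := hpos (hmem c v hc) (hmem c v' hc) hne
    have e : (c + v' * I : ℂ) - (c + v * I) = ((v' - v : ℝ) : ℂ) * I := by push_cast; ring
    rw [e] at h1
    simp at h1
    have h2 : 0 < v' - v := sub_pos.2 hv
    change (F (c + v * I)).im < (F (c + v' * I)).im
    nlinarith
  have hre : ∀ {ζ₁ ζ₂ : ℂ}, ζ₁ ∈ rightHalfPlane → ζ₂ ∈ rightHalfPlane → (F ζ₁).im = (F ζ₂).im →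
      ζ₁.re < ζ₂.re → (F ζ₁).re < (F ζ₂).re := by
    intro ζ₁ ζ₂ h₁ h₂ him hlt
    have h1 := hpos h₁ h₂ (fun h => hlt.ne (congrArg Complex.re h))
    simp [him] at h1
    nlinarith
  have hIm : ∀ ζ ∈ rightHalfPlane, (F ζ).im = (H ζ - G ζ).im := by
    intro ζ hζ
    rw [hF ζ hζ]
    simp
    ring
  -- the level curves of `Im F` are locally graphs over the real axis
  have hloc : ∀ c₀ v₀ : ℝ, 0 < c₀ → ∀ ε > 0, ∀ᶠ c : ℝ in 𝓝 c₀,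
      0 < c ∧ ∃ v ∈ Ioo (v₀ - ε) (v₀ + ε), (F (c + v * I)).im = (F (c₀ + v₀ * I)).im := by
    intro c₀ v₀ hc₀ ε hε
    have hcv : ∀ v : ℝ, ContinuousAt (fun c : ℝ => (F (c + v * I)).im) c₀ := fun v =>
      Complex.continuous_im.continuousAt.comp
        (ContinuousAt.comp (f := fun c : ℝ => (c + v * I : ℂ)) (hFat _ (hmem c₀ v hc₀))
          (by fun_prop))
    have h1 := (hcv (v₀ - ε)).eventually_lt_const (hmono c₀ hc₀ (by linarith : v₀ - ε < v₀))
    have h2 := (hcv (v₀ + ε)).eventually_const_lt (hmono c₀ hc₀ (by linarith : v₀ < v₀ + ε))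
    filter_upwards [h1, h2, lt_mem_nhds hc₀] with c h1 h2 hc
    refine ⟨hc, ?_⟩
    have hcont : ContinuousOn (fun v : ℝ => (F (c + v * I)).im) (Icc (v₀ - ε) (v₀ + ε)) :=
      Complex.continuous_im.comp_continuousOn
        (hFc.comp (by fun_prop) (fun v _ => hmem c v hc))
    exact intermediate_value_Ioo (by linarith) hcont ⟨h1, h2⟩
  have hpt : ∀ {x y : ℝ}, (x + y * I : ℂ) ∈ F '' rightHalfPlane →
      ∃ c v : ℝ, 0 < c ∧ F (c + v * I) = x + y * I := by
    rintro x y ⟨ζ, hζ, h⟩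
    exact ⟨ζ.re, ζ.im, hζ, by rw [Complex.re_add_im, h]⟩
  have hstep : ∀ x y : ℝ, (x + y * I : ℂ) ∈ F '' rightHalfPlane → ∃ c₀ v₀ : ℝ, 0 < c₀ ∧
      F (c₀ + v₀ * I) = x + y * I ∧ ∀ᶠ c : ℝ in 𝓝 c₀, 0 < c ∧ ∃ v : ℝ,
        F (c + v * I) = (F (c + v * I)).re + y * I := by
    intro x y hxy
    obtain ⟨c₀, v₀, hc₀, h⟩ := hpt hxy
    refine ⟨c₀, v₀, hc₀, h, (hloc c₀ v₀ hc₀ 1 one_pos).mono ?_⟩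
    rintro c ⟨hc, v, -, hv⟩
    refine ⟨hc, v, ?_⟩
    rw [h] at hv
    simp at hv
    rw [← hv, Complex.re_add_im]
  refine isCloseToConvexDomain_of_slices (fun y => ⟨?_⟩) ?_ ?_
  · rintro x₁ hx₁ x₂ hx₂ x ⟨hx₁x, hxx₂⟩
    rcases hx₁x.eq_or_lt with rfl | hx₁x
    · exact hx₁
    rcases hxx₂.eq_or_lt with rfl | hxx₂
    · exact hx₂
    obtain ⟨c₁, v₁, hc₁, h₁⟩ := hpt hx₁
    obtain ⟨c₂, v₂, hc₂, h₂⟩ := hpt hx₂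
    have hc12 : c₁ < c₂ := by
      by_contra! hle
      rcases hle.eq_or_lt with h | h
      · subst h
        have : v₂ = v₁ := (hmono c₂ hc₂).injective (by simp [h₁, h₂])
        rw [this, h₁] at h₂
        have := congrArg Complex.re h₂
        simp at this
        linarith
      · have := hre (hmem c₂ v₂ hc₂) (hmem c₁ v₁ hc₁) (by simp [h₁, h₂]) (by simpa using h)
        rw [h₁, h₂] at this
        simp at this
        linarith
    -- The value `y` is exceeded just above the given points over `c₁` and `c₂`; the minimum
    -- principle carries this to every `c` between them.
    have hup : ∀ c ∈ Icc c₁ c₂, ∃ v : ℝ, y < (F (c + v * I)).im := by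
      have hΦ : DifferentiableOn ℂ (fun ζ => H ζ - G ζ) rightHalfPlane := fun ζ hζ =>
        ((hH ζ hζ).sub (hG ζ hζ)).differentiableAt.differentiableWithinAt
      have hm : ∀ c : ℝ, 0 < c → StrictMono fun v : ℝ => (H (c + v * I) - G (c + v * I)).im := by
        intro c hc v v' hv
        simpa only [hIm _ (hmem c _ hc)] using hmono c hc hv
      have e₁ : ∃ v : ℝ, y < (F (c₁ + v * I)).im := by
        refine ⟨v₁ + 1, lt_of_eq_of_lt ?_ (hmono c₁ hc₁ (lt_add_one v₁))⟩
        simp [h₁]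
      have e₂ : ∃ v : ℝ, y < (F (c₂ + v * I)).im := by
        refine ⟨v₂ + 1, lt_of_eq_of_lt ?_ (hmono c₂ hc₂ (lt_add_one v₂))⟩
        simp [h₂]
      intro c hc
      rcases hc.1.eq_or_lt with rfl | h
      · exact e₁
      rcases hc.2.eq_or_lt with rfl | h'
      · exact e₂
      simp only [hIm _ (hmem c₁ _ hc₁), hIm _ (hmem c₂ _ hc₂), hIm _ (hmem c _ (hc₁.trans h))]
        at e₁ e₂ ⊢
      exact exists_im_gt_of_mem_Ioo hΦ hm hc₁ ⟨h, h'⟩ e₁ e₂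
    have hdown : ∀ c ∈ Icc c₁ c₂, ∃ v : ℝ, (F (c + v * I)).im < y := by
      -- Reflection in the real axis turns values of `Im F` below `y` into values above `-y` and
      -- preserves upward monotonicity.
      set Φ : ℂ → ℂ := fun ζ =>
        (starRingEnd ℂ) (H ((starRingEnd ℂ) ζ) - G ((starRingEnd ℂ) ζ)) with hΦdef
      have hΦF : ∀ c v : ℝ, 0 < c → (Φ (c + v * I)).im = -(F (c + (-v : ℝ) * I)).im := by
        intro c v hc
        rw [hIm _ (hmem c (-v) hc)]
        have : (starRingEnd ℂ) (c + v * I : ℂ) = c + (-v : ℝ) * I := by simp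
        simp only [hΦdef, this, Complex.conj_im]
      have hΦ : DifferentiableOn ℂ Φ rightHalfPlane := fun ζ hζ => by
        have hζ' : (starRingEnd ℂ) ζ ∈ rightHalfPlane := by simpa [rightHalfPlane] using hζ
        have h3 := ((hH _ hζ').sub (hG _ hζ')).differentiableAt.conj_conj
        rw [Complex.conj_conj] at h3
        exact h3.differentiableWithinAt
      have hm : ∀ c : ℝ, 0 < c → StrictMono fun v : ℝ => (Φ (c + v * I)).im := by
        intro c hc v v' hv
        simp only [hΦF c _ hc]
        exact neg_lt_neg (hmono c hc (neg_lt_neg hv))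
      have e₁ : ∃ v : ℝ, -y < (Φ (c₁ + v * I)).im := by
        refine ⟨-(v₁ - 1), ?_⟩
        rw [hΦF c₁ _ hc₁, neg_neg, neg_lt_neg_iff]
        refine lt_of_lt_of_eq (hmono c₁ hc₁ (sub_one_lt v₁)) ?_
        simp [h₁]
      have e₂ : ∃ v : ℝ, -y < (Φ (c₂ + v * I)).im := by
        refine ⟨-(v₂ - 1), ?_⟩
        rw [hΦF c₂ _ hc₂, neg_neg, neg_lt_neg_iff]
        refine lt_of_lt_of_eq (hmono c₂ hc₂ (sub_one_lt v₂)) ?_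
        simp [h₂]
      intro c hc
      have hc0 : 0 < c := hc₁.trans_le hc.1
      suffices h : ∃ v : ℝ, -y < (Φ (c + v * I)).im by
        obtain ⟨v, hv⟩ := h
        rw [hΦF c v hc0, neg_lt_neg_iff] at hv
        exact ⟨-v, hv⟩
      rcases hc.1.eq_or_lt with rfl | h
      · exact e₁
      rcases hc.2.eq_or_lt with rfl | h'
      · exact e₂
      exact exists_im_gt_of_mem_Ioo hΦ hm hc₁ ⟨h, h'⟩ e₁ e₂
    have hlev : ∀ c : ℝ, ∃ v : ℝ, c ∈ Icc c₁ c₂ → (F (c + v * I)).im = y := by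
      intro c
      by_cases hc : c ∈ Icc c₁ c₂
      · obtain ⟨a, ha⟩ := hdown c hc
        obtain ⟨b, hb⟩ := hup c hc
        have hcont : Continuous fun v : ℝ => (F (c + v * I)).im :=
          Complex.continuous_im.comp
            (hFc.comp_continuous (by fun_prop) (fun v => hmem c v (hc₁.trans_le hc.1)))
        obtain ⟨v, hv⟩ := mem_range_of_exists_le_of_exists_ge hcont ⟨a, ha.le⟩ ⟨b, hb.le⟩
        exact ⟨v, fun _ => hv⟩
      · exact ⟨0, fun h => absurd h hc⟩
    choose V hV using hlev
    -- `hloc` supplies a nearby point of the level set over `c'`, and monotonicity on vertical lines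
    -- forces it to be `V c'`.
    have hVc : ContinuousOn V (Icc c₁ c₂) := by
      intro c hc
      rw [ContinuousWithinAt, Metric.tendsto_nhds]
      intro ε hε
      filter_upwards [nhdsWithin_le_nhds (hloc c (V c) (hc₁.trans_le hc.1) ε hε),
        self_mem_nhdsWithin] with c' h hc'
      obtain ⟨hc'0, v, hv, he⟩ := h
      have : V c' = v := (hmono c' hc'0).injective (by simp only [hV c' hc', he, hV c hc])
      rw [this, Real.dist_eq, abs_lt]
      constructor <;> linarith [hv.1, hv.2]
    have hXc : ContinuousOn (fun c : ℝ => (F (c + V c * I)).re) (Icc c₁ c₂) := by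
      refine Complex.continuous_re.comp_continuousOn (hFc.comp ?_
        (fun c hc => hmem c (V c) (hc₁.trans_le hc.1)))
      exact (Complex.continuous_ofReal.continuousOn).add
        ((Complex.continuous_ofReal.comp_continuousOn hVc).mul continuousOn_const)
    have hV₁ : V c₁ = v₁ := (hmono c₁ hc₁).injective (by simp [hV c₁ ⟨le_rfl, hc12.le⟩, h₁])
    have hV₂ : V c₂ = v₂ := (hmono c₂ hc₂).injective (by simp [hV c₂ ⟨hc12.le, le_rfl⟩, h₂])
    have hx : x ∈ Icc (F (c₁ + V c₁ * I)).re (F (c₂ + V c₂ * I)).re := by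
      rw [hV₁, hV₂, h₁, h₂]
      simpa using ⟨hx₁x.le, hxx₂.le⟩
    obtain ⟨c, hc, hcx⟩ := intermediate_value_Icc hc12.le hXc hx
    refine ⟨c + V c * I, hmem c _ (hc₁.trans_le hc.1), ?_⟩
    rw [← hcx, ← hV c hc]
    exact (Complex.re_add_im _).symm
  -- The level curve continues to the right of `c₀`, and `Re F` is larger there; moving left treats
  -- the other end.
  · intro x y hxy
    obtain ⟨c₀, v₀, hc₀, h, hev⟩ := hstep x y hxy
    obtain ⟨c, ⟨hc, v, hv⟩, hlt⟩ :=
      ((hev.filter_mono nhdsWithin_le_nhds).and (self_mem_nhdsWithin (s := Ioi c₀))).exists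
    refine ⟨(F (c + v * I)).re, ?_, ⟨_, hmem c v hc, hv⟩⟩
    have := hre (hmem c₀ v₀ hc₀) (hmem c v hc) (by rw [h, hv]; simp) (by simpa using hlt)
    rwa [h, add_re, ofReal_re, Complex.re_ofReal_mul, I_re, mul_zero, add_zero] at this
  · intro x y hxy
    obtain ⟨c₀, v₀, hc₀, h, hev⟩ := hstep x y hxy
    obtain ⟨c, ⟨hc, v, hv⟩, hlt⟩ :=
      ((hev.filter_mono nhdsWithin_le_nhds).and (self_mem_nhdsWithin (s := Iio c₀))).exists
    refine ⟨(F (c + v * I)).re, ?_, ⟨_, hmem c v hc, hv⟩⟩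
    have := hre (hmem c v hc) (hmem c₀ v₀ hc₀) (by rw [h, hv]; simp) (by simpa using hlt)
    rwa [h, add_re, ofReal_re, Complex.re_ofReal_mul, I_re, mul_zero, add_zero] at this

/-! ### Univalence and close-to-convexity of `f`. -/

theorem mainTheorem8 (α : ℝ) (hα : α ∈ Set.Ioo (1 : ℝ) 2) (θ : ℝ) (f ω : ℂ → ℂ)
    (hf : IsConcaveHarmonic α f ω)
    (hω : ∀ z ∈ unitDisk, ω z =
      (Real.sin ((2 - α) / 2 * Real.pi) : ℂ) * Complex.exp ((θ : ℂ) * Complex.I) * z) :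
    Set.InjOn f unitDisk ∧ IsCloseToConvexDomain (f '' unitDisk) := by
  obtain ⟨h, g, hh, hgd, hg, hfe⟩ := hf
  obtain ⟨c, hc1, hc⟩ := hh.exists_rotation hα
  have hc0 : c ≠ 0 := norm_ne_zero_iff.1 (hc1 ▸ one_ne_zero)
  have hs : 0 < Real.sin ((2 - α) / 2 * Real.pi) := by
    have := Real.pi_pos
    refine Real.sin_pos_of_pos_of_lt_pi ?_ ?_
    · nlinarith [hα.2]
    · nlinarith [hα.1]
  set s := Real.sin ((2 - α) / 2 * Real.pi)
  have h1 : ‖(1 : ℂ)‖ = 1 := norm_one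
  set F : ℂ → ℂ := fun ζ => c * f (toDisk 1 ζ) with hF
  have hH : ∀ ζ ∈ rightHalfPlane, HasDerivAt (fun ζ => c * h (toDisk 1 ζ))
      (c * (deriv h (toDisk 1 ζ) * (2 * 1 / (ζ + 1) ^ 2))) ζ := fun ζ hζ =>
    (((hh.analytic.differentiableAt (isOpen_unitDisk.mem_nhds (toDisk_mem h1 hζ))).hasDerivAt).comp ζ
      (hasDerivAt_toDisk 1 (le_of_lt hζ))).const_mul c
  have hG : ∀ ζ ∈ rightHalfPlane, HasDerivAt (fun ζ => (starRingEnd ℂ) c * g (toDisk 1 ζ))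
      ((starRingEnd ℂ) c * (deriv g (toDisk 1 ζ) * (2 * 1 / (ζ + 1) ^ 2))) ζ := fun ζ hζ =>
    (((hgd.differentiableAt (isOpen_unitDisk.mem_nhds (toDisk_mem h1 hζ))).hasDerivAt).comp ζ
      (hasDerivAt_toDisk 1 (le_of_lt hζ))).const_mul _
  have hHG : ∀ ζ ∈ rightHalfPlane,
      ‖(starRingEnd ℂ) c * (deriv g (toDisk 1 ζ) * (2 * 1 / (ζ + 1) ^ 2))‖ <
        (c * (deriv h (toDisk 1 ζ) * (2 * 1 / (ζ + 1) ^ 2))).re := by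
    intro ζ hζ
    have hz := toDisk_mem h1 hζ
    set z := toDisk 1 ζ with hzdef
    obtain ⟨hder, hsec⟩ := hc z hz
    have hζ1 := add_one_ne_zero_of_re_nonneg (le_of_lt hζ)
    -- From `1 - z = 2 / (ζ + 1)`: the quantity in the sector condition is twice the derivative of
    -- the half-plane function.
    have hA : c * (deriv h z * (1 - z) ^ 2) =
        (2 : ℝ) * (c * (deriv h z * (2 * 1 / (ζ + 1) ^ 2))) := by
      rw [hzdef, sub_toDisk 1 (le_of_lt hζ), div_pow]
      push_cast
      ring
    rw [hA, Complex.re_ofReal_mul, norm_mul, Complex.norm_real, Real.norm_of_nonneg zero_le_two]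
      at hsec
    set A := c * (deriv h z * (2 * 1 / (ζ + 1) ^ 2)) with hAdef
    have hA0 : 0 < ‖A‖ := by
      rw [norm_pos_iff, hAdef]
      exact mul_ne_zero hc0 (mul_ne_zero hder (div_ne_zero (by norm_num) (pow_ne_zero _ hζ1)))
    have hGA : ‖(starRingEnd ℂ) c * (deriv g z * (2 * 1 / (ζ + 1) ^ 2))‖ = s * ‖z‖ * ‖A‖ := by
      rw [(hg z hz).2, hω z hz, hAdef]
      simp only [norm_mul, RCLike.norm_conj, Complex.norm_exp_ofReal_mul_I, Complex.norm_real,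
        Real.norm_of_nonneg hs.le]
      ring
    rw [hGA]
    have hz1 : ‖z‖ < 1 := hz
    -- The sector condition has exactly the constant `s` of the dilatation, so the strict inequality
    -- comes only from `‖z‖ < 1`.
    have h3 : s * ‖z‖ * ‖A‖ < s * ‖A‖ := by
      have := mul_lt_mul_of_pos_left hz1 (mul_pos hs hA0)
      linarith
    linarith
  have hFe : ∀ ζ ∈ rightHalfPlane, F ζ = c * h (toDisk 1 ζ) +
      (starRingEnd ℂ) ((starRingEnd ℂ) c * g (toDisk 1 ζ)) := by
    intro ζ hζ
    simp only [hF]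
    rw [hfe _ (toDisk_mem h1 hζ), map_mul, Complex.conj_conj, mul_add]
  refine ⟨?_, ?_⟩
  · intro z₁ hz₁ z₂ hz₂ he
    obtain ⟨ζ₁, hζ₁, rfl⟩ := exists_toDisk_eq h1 hz₁
    obtain ⟨ζ₂, hζ₂, rfl⟩ := exists_toDisk_eq h1 hz₂
    by_contra hne
    have := re_conj_mul_sub_pos hH hG hHG hFe hζ₁ hζ₂ (fun h' => hne (by rw [h']))
    simp [hF, he] at this
  · have himg : f '' unitDisk = (c⁻¹ * ·) '' (F '' rightHalfPlane) := by
      ext w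
      constructor
      · rintro ⟨z, hz, rfl⟩
        obtain ⟨ζ, hζ, rfl⟩ := exists_toDisk_eq h1 hz
        exact ⟨_, ⟨ζ, hζ, rfl⟩, inv_mul_cancel_left₀ hc0 _⟩
      · rintro ⟨_, ⟨ζ, hζ, rfl⟩, rfl⟩
        exact ⟨_, toDisk_mem h1 hζ, (inv_mul_cancel_left₀ hc0 _).symm⟩
    rw [himg]
    exact (isCloseToConvexDomain_image_rightHalfPlane hH hG hHG hFe).image_mul (inv_ne_zero hc0)
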